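/- Let $\Omega\subset\mathbb R^2$ be an open set and let $\mathcal K(\Omega)$ be the class of all compact connected sets $K\subset\overline\Omega$ with $\mathcal H^1(K)<+\infty$, where $\mathcal H^1$ is the one-dimensional Hausdorff measure. Let $K\in\mathcal K(\Omega)$ and let $L^2(K)=L^2(K,\mathcal H^1)$. At $\mathcal H^1$-almost every $x\in K$ the set $K$ has an approximate tangent line; let $\tau_K(x)$ be a unit vector in its direction. Let $\mathcal D(K)$ be the space of restrictions to $K$ of functions $\varphi\in C^\infty(\mathbb R^2)$, with the norm $$N(\varphi)=\Big(\int_K\varphi^2\,d\mathcal H^1+\int_K|\nabla\varphi\cdot\tau_K|^2\,d\mathcal H^1\Big)^{1/2},$$ functions that agree $\mathcal H^1$-almost everywhere on $K$ being identified. Let $H^1(K)$ be the completion of $\mathcal D(K)$ for the norm $N$, that is, the closure of the set of pairs $(\varphi|_K,(\nabla\varphi\cdot\tau_K)\tau_K)$ in $L^2(K)\times L^2(K;\mathbb R^2)$. Its elements are pairs $(u,\nabla_Ku)$, with norm $(\|u\|_{L^2(K)}^2+\|\nabla_Ku\|_{L^2(K)}^2)^{1/2}$. Then the map $H^1(K)\to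 L^2(K)$, $(u,\nabla_Ku)\mapsto u$, is injective (so that $H^1(K)$ embeds in $L^2(K)$), and this embedding $H^1(K)\hookrightarrow L^2(K)$ is compact. More precisely, for every bounded sequence $(u_n)_{n\in\mathbb N}$ in $H^1(K)$, the functions $u_n$ have $L^2$-representatives that are continuous on $K$, and some subsequence of these representatives converges uniformly on $K$ to a continuous function. In particular the corresponding subsequence of $(u_n)$ converges to that function in $L^2(K)$. -/

import Mathlib

open MeasureTheory Filter Topology Set
open scoped ENNReal ContDiff RealInnerProductSpace

noncomputable section

namespace SobolevCurve

/-- The Euclidean plane. -/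
abbrev Plane : Type := EuclideanSpace ℝ (Fin 2)

/-- The class of compact connected subsets of the closure of `Ω` with finite length. -/
def admissible (Ω : Set Plane) : Set (Set Plane) :=
  {K | K ⊆ closure Ω ∧ IsCompact K ∧ IsConnected K ∧ Measure.hausdorffMeasure 1 K < ⊤}

/-- The one-dimensional Hausdorff measure restricted to `K`. -/
def length (K : Set Plane) : Measure Plane :=
  (Measure.hausdorffMeasure 1).restrict K

/-- The points `y` that lie outside the open two-sided cone with vertex `x`, axis `x + L` and
aperture `s`, i.e. the points with `dist (y - x, L) ≥ s |y - x|`. -/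
def coneCompl (x : Plane) (L : Submodule ℝ Plane) (s : ℝ) : Set Plane :=
  {y | s * ‖y - x‖ ≤ Metric.infDist (y - x) (L : Set Plane)}

/-- `L` is the (direction of the) approximate tangent line to `K` at `x`: it is a line, the upper
one-dimensional density of `K` at `x` is positive, and outside every two-sided cone about `x + L`
the set `K` has density zero at `x`. Such a line is unique if it exists. -/
structure IsApproxTangentLine (K : Set Plane) (x : Plane) (L : Submodule ℝ Plane) : Prop where
  finrank_eq_one : Module.finrank ℝ L = 1
  upperDensity_pos :
    0 < limsup (fun r : ℝ => length K (Metric.closedBall x r) / ENNReal.ofReal (2 * r)) (𝓝[>] 0)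
  density_coneCompl : ∀ s : ℝ, 0 < s → s < 1 →
    Tendsto (fun r : ℝ =>
      length K (Metric.closedBall x r ∩ coneCompl x L s) / ENNReal.ofReal (2 * r)) (𝓝[>] 0) (𝓝 0)

open Classical in
/-- A unit vector `τ_K(x)` in the direction of the approximate tangent line to `K` at `x`. For `K`
compact, connected and of finite length that line exists at almost every `x ∈ K`; where it does
not exist, the value is `0`. Only the line, not the sign, matters below. -/
def unitTangent (K : Set Plane) (x : Plane) : Plane :=
  if h : ∃ v : Plane, ‖v‖ = 1 ∧ IsApproxTangentLine K x (Submodule.span ℝ {v}) then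
    h.choose
  else 0

/-- The tangential gradient `(∇φ · τ_K) τ_K` of a smooth function `φ` on the plane. -/
def tangentialGradient (K : Set Plane) (φ : Plane → ℝ) (x : Plane) : Plane :=
  ⟪gradient φ x, unitTangent K x⟫ • unitTangent K x

/-- `L²(K)`, with respect to the length measure on `K`. -/
abbrev L2 (K : Set Plane) : Type := Lp ℝ 2 (length K)

/-- `L²(K; ℝ²)`. -/
abbrev L2Vec (K : Set Plane) : Type := Lp Plane 2 (length K)

lemma tangentialGradient_add (K : Set Plane) {φ ψ : Plane → ℝ} (hφ : ContDiff ℝ ∞ φ)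
    (hψ : ContDiff ℝ ∞ ψ) (x : Plane) :
    tangentialGradient K (φ + ψ) x = tangentialGradient K φ x + tangentialGradient K ψ x := by
  have h1 : DifferentiableAt ℝ φ x := (hφ.differentiable (by simp)) x
  have h2 : DifferentiableAt ℝ ψ x := (hψ.differentiable (by simp)) x
  simp only [tangentialGradient, gradient, fderiv_add h1 h2, map_add, inner_add_left, add_smul]

lemma tangentialGradient_smul (K : Set Plane) (c : ℝ) {φ : Plane → ℝ} (hφ : ContDiff ℝ ∞ φ)
    (x : Plane) : tangentialGradient K (c • φ) x = c • tangentialGradient K φ x := by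
  have h1 : DifferentiableAt ℝ φ x := (hφ.differentiable (by simp)) x
  simp [tangentialGradient, gradient, fderiv_const_smul h1, inner_smul_left, mul_smul]

/-- The space `𝒟(K)` of restrictions to `K` of smooth functions `φ` on the plane, each `φ|_K` being
recorded together with its tangential gradient, as a pair in `L²(K) × L²(K; ℝ²)`. The `ℓ²` product
norm of the pair is `N(φ) = (∫_K φ² dℋ¹ + ∫_K |∇φ · τ_K|² dℋ¹)^(1/2)`. -/
def smoothFunctions (K : Set Plane) : Submodule ℝ (WithLp 2 (L2 K × L2Vec K)) where
  carrier := {p | ∃ φ : Plane → ℝ, ContDiff ℝ ∞ φ ∧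
    p.fst =ᵐ[length K] φ ∧ p.snd =ᵐ[length K] tangentialGradient K φ}
  zero_mem' := by
    refine ⟨0, contDiff_const, Lp.coeFn_zero _ _ _, ?_⟩
    refine (Lp.coeFn_zero _ _ _).trans (Eventually.of_forall fun x => ?_)
    have h : fderiv ℝ (0 : Plane → ℝ) x = 0 := by simp
    simp [tangentialGradient, gradient, h]
  add_mem' := by
    rintro p q ⟨φ, hφ, h1, h2⟩ ⟨ψ, hψ, h3, h4⟩
    refine ⟨φ + ψ, hφ.add hψ, (Lp.coeFn_add _ _).trans (h1.add h3), ?_⟩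
    refine ((Lp.coeFn_add _ _).trans (h2.add h4)).trans (Eventually.of_forall fun x => ?_)
    exact (tangentialGradient_add K hφ hψ x).symm
  smul_mem' := by
    rintro c p ⟨φ, hφ, h1, h2⟩
    refine ⟨c • φ, hφ.const_smul c, (Lp.coeFn_smul _ _).trans (h1.const_smul c), ?_⟩
    refine ((Lp.coeFn_smul _ _).trans (h2.const_smul c)).trans (Eventually.of_forall fun x => ?_)
    exact (tangentialGradient_smul K c hφ x).symm

/-- The Sobolev space `H¹(K)`: the completion of `𝒟(K)` for the norm `N`, realized as the closure
of `𝒟(K)` in the Hilbert space `L²(K) × L²(K; ℝ²)`. Its elements are the pairs `(u, ∇_K u)`, and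
their norm is `(‖u‖² + ‖∇_K u‖²)^(1/2)`. -/
def H1 (K : Set Plane) : Submodule ℝ (WithLp 2 (L2 K × L2Vec K)) :=
  (smoothFunctions K).topologicalClosure

/-- The canonical map `H¹(K) → L²(K)`, `(u, ∇_K u) ↦ u`. -/
def H1.toL2 (K : Set Plane) : H1 K →L[ℝ] L2 K :=
  (WithLp.fstL 2 ℝ (L2 K) (L2Vec K)).comp (H1 K).subtypeL

end SobolevCurve

end

open scoped NNReal

namespace SobolevCurve

/-! On a curve, an `L²` bound on the derivative gives a Hölder bound of exponent 1/2, and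
Arzelà–Ascoli then gives compactness. A continuum `K` of finite length is a Lipschitz image `f ''
Icc 0 1` (`exists_lipschitz_parametrization`), so estimates can be made along arcs of `f`.

The basic estimate (`IsSmoothPair.ofReal_abs_sub_le`) bounds the oscillation of a smooth `φ` along
an arc by the integral of its tangential gradient over the trace `E` of the arc. It avoids the area
formula: `φ '' E` is connected, hence contains the interval between the two end values, while its
length is at most the integral over `E` of the pointwise Lipschitz constant of `φ` along `K`
(`hausdorffMeasure_image_le_lintegral`). That constant is at most the tangential gradient, because
at almost every point all branches of `f` have nonzero velocities parallel to the unit tangent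
(`ae_isRegularPoint_unitTangent`). Cauchy–Schwarz gives the Hölder bound in the parameter, and
comparison with the `L²` norm gives a uniform bound. Both pass to the closure `H1 K`.

Injectivity says that the gradient is closable. If `φₘ → 0` in `L²` and the tangential gradients
tend to `g`, the continuous representative of the limit is zero, so the oscillation of `φₘ` along
arcs is bounded by integrals of `|g - ∇φₘ|`. Differentiating at a regular Lebesgue point bounds the
tangential gradient of `φₘ` by `C |g - ∇φₘ|`, with `C` independent of `m`
(`IsRegularPoint.exists_ofReal_abs_inner_le`). Letting `m → ∞` along an almost everywhere convergent
subsequence gives `g = 0`. -/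

/-- A connected set reaching out of a ball about one of its points has length at least the radius
of the ball inside the ball. -/
lemma ofReal_le_hausdorffMeasure_inter_ball {X : Type*} [MetricSpace X] [MeasurableSpace X]
    [BorelSpace X] {C : Set X} (hC : IsPreconnected C) {x y : X}
    (hx : x ∈ C) (hy : y ∈ C) {r : ℝ} (hr : r ≤ dist y x) :
    ENNReal.ofReal r ≤ Measure.hausdorffMeasure 1 (C ∩ Metric.ball x r) := by
  have hL : LipschitzOnWith 1 (fun z => dist z x) (C ∩ Metric.ball x r) :=
    (LipschitzWith.dist_left x).lipschitzOnWith
  have h1 := hL.hausdorffMeasure_image_le (zero_le_one (α := ℝ))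
  -- The distance to `x` is 1-Lipschitz and, by connectedness, takes every value in `[0, r)` on `C`.
  have h2 : Ico 0 r ⊆ (fun z => dist z x) '' (C ∩ Metric.ball x r) := by
    intro t ht
    have h3 := hC.intermediate_value hx hy (f := fun z => dist z x)
      (continuous_id.dist continuous_const).continuousOn
    obtain ⟨z, hz, hzt⟩ := h3 (show t ∈ Icc _ _ by
      simp only [dist_self]; exact ⟨ht.1, ht.2.le.trans hr⟩)
    simp only at hzt
    exact ⟨z, ⟨hz, by rw [Metric.mem_ball, hzt]; exact ht.2⟩, hzt⟩
  calc ENNReal.ofReal r = Measure.hausdorffMeasure 1 (Ico (0 : ℝ) r) := by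
        rw [hausdorffMeasure_real]; simp
    _ ≤ Measure.hausdorffMeasure 1 ((fun z => dist z x) '' (C ∩ Metric.ball x r)) :=
        measure_mono h2
    _ ≤ Measure.hausdorffMeasure 1 (C ∩ Metric.ball x r) := by simpa using h1

/-! ### Length of images and the pointwise Lipschitz constant -/

section HausdorffImage

variable {X Y : Type*} [MetricSpace X] [TopologicalSpace.SeparableSpace X] [MeasurableSpace X]
  [BorelSpace X] [MetricSpace Y] [MeasurableSpace Y] [BorelSpace Y]

/-- A map which is `c`-Lipschitz on the pairs of points of `E` at small distance increases the
length of `E` at most by the factor `c`. -/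
lemma hausdorffMeasure_image_le_of_dist_lt {φ : X → Y} {E : Set X} {c : ℝ≥0} {δ : ℝ} (hδ : 0 < δ)
    (h : ∀ x ∈ E, ∀ y ∈ E, dist x y < δ → dist (φ x) (φ y) ≤ c * dist x y) :
    Measure.hausdorffMeasure 1 (φ '' E) ≤ c * Measure.hausdorffMeasure 1 E := by
  obtain ⟨A, hAm, hAb, hAd, hAU, hAdisj⟩ :=
    SeparableSpace.exists_measurable_partition_diam_le X (half_pos hδ)
  have hE : E = ⋃ n, E ∩ A n := by rw [← inter_iUnion, hAU, inter_univ]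
  have hpiece : ∀ n, Measure.hausdorffMeasure 1 (φ '' (E ∩ A n)) ≤
      c * Measure.hausdorffMeasure 1 (E ∩ A n) := by
    intro n
    have hL : LipschitzOnWith c φ (E ∩ A n) := by
      refine LipschitzOnWith.of_dist_le_mul fun x hx y hy => h x hx.1 y hy.1 ?_
      have := Metric.dist_le_diam_of_mem (hAb n) hx.2 hy.2
      linarith [hAd n]
    simpa using hL.hausdorffMeasure_image_le (zero_le_one (α := ℝ))
  -- `E` need not be measurable: additivity comes from the measurable cells `A n`, through the
  -- measure restricted to `E`.
  have hsum : ∑' n, Measure.hausdorffMeasure 1 (E ∩ A n) =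
      (Measure.hausdorffMeasure 1 : Measure X) E := by
    have h1 := measure_iUnion (μ := (Measure.hausdorffMeasure 1 : Measure X).restrict E)
      hAdisj hAm
    rw [hAU, Measure.restrict_apply_univ] at h1
    rw [h1]
    refine tsum_congr fun n => ?_
    rw [Measure.restrict_apply (hAm n), inter_comm]
  calc Measure.hausdorffMeasure 1 (φ '' E)
      = Measure.hausdorffMeasure 1 (⋃ n, φ '' (E ∩ A n)) := by rw [← image_iUnion, ← hE]
    _ ≤ ∑' n, Measure.hausdorffMeasure 1 (φ '' (E ∩ A n)) := measure_iUnion_le _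
    _ ≤ ∑' n, c * Measure.hausdorffMeasure 1 (E ∩ A n) := ENNReal.tsum_le_tsum hpiece
    _ = c * Measure.hausdorffMeasure 1 E := by rw [ENNReal.tsum_mul_left, hsum]

/-- A map whose pointwise Lipschitz constant relative to `E` is at most `c` at every point of `E`
increases the length of `E` at most by the factor `c`. -/
lemma hausdorffMeasure_image_le_of_eventually {φ : X → Y} {E : Set X} {c : ℝ≥0}
    (h : ∀ x ∈ E, ∀ᶠ y in 𝓝[E] x, dist (φ x) (φ y) ≤ c * dist x y) :
    Measure.hausdorffMeasure 1 (φ '' E) ≤ c * Measure.hausdorffMeasure 1 E := by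
  -- On `F n` the bound holds at one common scale. These sets increase to `E`, and continuity from
  -- below needs no measurability of them.
  let F : ℕ → Set X := fun n =>
    {x ∈ E | ∀ y ∈ E, dist x y < 1 / ((n : ℝ) + 1) → dist (φ x) (φ y) ≤ c * dist x y}
  have hFmono : Monotone F := by
    intro m n hmn x hx
    exact ⟨hx.1, fun y hy hxy => hx.2 y hy (hxy.trans_le (Nat.one_div_le_one_div hmn))⟩
  have hFE : ⋃ n, F n = E := by
    refine Subset.antisymm (iUnion_subset fun n x hx => hx.1) fun x hx => ?_
    obtain ⟨δ, hδ, hδ'⟩ := Metric.eventually_nhds_iff.1 (eventually_nhdsWithin_iff.1 (h x hx))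
    obtain ⟨n, hn⟩ := exists_nat_one_div_lt hδ
    exact mem_iUnion.2 ⟨n, hx, fun y hy hxy => hδ' (by rw [dist_comm]; exact hxy.trans hn) hy⟩
  calc Measure.hausdorffMeasure 1 (φ '' E)
      = Measure.hausdorffMeasure 1 (⋃ n, φ '' F n) := by rw [← image_iUnion, hFE]
    _ = ⨆ n, Measure.hausdorffMeasure 1 (φ '' F n) :=
        Monotone.measure_iUnion fun m n hmn => image_mono (hFmono hmn)
    _ ≤ c * Measure.hausdorffMeasure 1 E := by
        refine iSup_le fun n => ?_
        refine (hausdorffMeasure_image_le_of_dist_lt (δ := 1 / ((n : ℝ) + 1)) (by positivity)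
          fun x hx y hy hxy => hx.2 y hy.1 hxy).trans ?_
        gcongr
        exact fun x hx => hx.1

/-- The length of an image is bounded by the integral of the pointwise Lipschitz constant. -/
lemma hausdorffMeasure_image_le_lintegral {φ : X → Y} {E : Set X}
    (hfin : Measure.hausdorffMeasure 1 E ≠ ⊤) (hE : MeasurableSet E) {G : X → ℝ≥0}
    (hG : Measurable G)
    (hnull : ∀ N ⊆ E, Measure.hausdorffMeasure 1 N = 0 → Measure.hausdorffMeasure 1 (φ '' N) = 0)
    (h : ∀ᵐ x ∂(Measure.hausdorffMeasure 1).restrict E, ∀ ε : ℝ≥0, 0 < ε →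
      ∀ᶠ y in 𝓝[E] x, dist (φ x) (φ y) ≤ (G x + ε) * dist x y) :
    Measure.hausdorffMeasure 1 (φ '' E) ≤ ∫⁻ x in E, G x ∂Measure.hausdorffMeasure 1 := by
  set μ : Measure X := (Measure.hausdorffMeasure 1).restrict E with hμ
  have hμE : μ univ ≠ ⊤ := by rwa [hμ, Measure.restrict_apply_univ]
  suffices H : ∀ ε : ℝ≥0, 0 < ε → Measure.hausdorffMeasure 1 (φ '' E) ≤
      ∫⁻ x, G x ∂μ + ε * (2 * μ univ) by
    refine ENNReal.le_of_forall_pos_le_add fun ε hε _ => ?_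
    set a : ℝ≥0 := (2 * μ univ).toNNReal with ha
    have ha' : (a : ℝ≥0∞) = 2 * μ univ :=
      ENNReal.coe_toNNReal (ENNReal.mul_ne_top (by simp) hμE)
    refine (H (ε / (a + 1)) (by positivity)).trans ?_
    gcongr
    rw [← ha', ← ENNReal.coe_mul, ENNReal.coe_le_coe, div_mul_eq_mul_div]
    refine div_le_of_le_mul₀ (by positivity) (by positivity) ?_
    gcongr
    exact le_self_add
  intro ε hε
  let S : Set X := {x | ∀ ε : ℝ≥0, 0 < ε →
    ∀ᶠ y in 𝓝[E] x, dist (φ x) (φ y) ≤ (G x + ε) * dist x y}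
  -- Slices on which `G` lies between `n * ε` and `(n + 1) * ε`. There the pointwise constant is at
  -- most `(n + 2) * ε ≤ G + 2 * ε`, which produces the error `ε * (2 * μ univ)`.
  let A : ℕ → Set X := fun n => {x | ⌊G x / ε⌋₊ = n}
  have hAm : ∀ n, MeasurableSet (A n) := fun n =>
    (Nat.measurable_floor.comp (hG.div_const ε)) (measurableSet_singleton n)
  have hAdisj : Pairwise (Function.onFun Disjoint A) := by
    intro m n hmn
    refine Set.disjoint_left.2 fun x hx hy => hmn ?_
    exact hx.symm.trans hy
  have hAU : ⋃ n, A n = univ := eq_univ_of_forall fun x => mem_iUnion.2 ⟨_, rfl⟩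
  have hN : Measure.hausdorffMeasure 1 (φ '' (E \ S)) = 0 := by
    refine hnull _ sdiff_subset ?_
    have h2 : μ Sᶜ = 0 := h
    rw [hμ, Measure.restrict_apply' hE] at h2
    rwa [sdiff_eq, inter_comm]
  have hcover : φ '' E ⊆ (⋃ n, φ '' (E ∩ S ∩ A n)) ∪ φ '' (E \ S) := by
    rw [← image_iUnion, ← image_union]
    refine image_mono fun x hx => ?_
    rw [← inter_iUnion, hAU, inter_univ, inter_union_sdiff]
    exact hx
  have hpiece : ∀ n, Measure.hausdorffMeasure 1 (φ '' (E ∩ S ∩ A n)) ≤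
      ∫⁻ x in A n, (G x + 2 * ε) ∂μ := by
    intro n
    have hle : ∀ x ∈ A n, G x ≤ (n + 1) * ε ∧ n * ε ≤ G x := by
      intro x hx
      have hx' : ⌊G x / ε⌋₊ = n := hx
      have h1 := Nat.lt_floor_add_one (G x / ε)
      have h2 := Nat.floor_le (zero_le (a := G x / ε))
      rw [hx'] at h1 h2
      exact ⟨((div_lt_iff₀ hε).1 h1).le, (le_div_iff₀ hε).1 h2⟩
    have h1 : Measure.hausdorffMeasure 1 (φ '' (E ∩ S ∩ A n)) ≤
        ((n + 2) * ε : ℝ≥0) * Measure.hausdorffMeasure 1 (E ∩ S ∩ A n) := by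
      refine hausdorffMeasure_image_le_of_eventually fun x hx => ?_
      have := (hx.1.2 ε hε).filter_mono
        (nhdsWithin_mono x (inter_subset_left.trans inter_subset_left : E ∩ S ∩ A n ⊆ E))
      refine this.mono fun y hy => hy.trans ?_
      gcongr
      have := (hle x hx.2).1
      have h3 : G x + ε ≤ (n + 2) * ε := by
        calc G x + ε ≤ (n + 1) * ε + ε := by gcongr
          _ = (n + 2) * ε := by ring
      exact_mod_cast h3
    have h2 : Measure.hausdorffMeasure 1 (E ∩ S ∩ A n) ≤ μ (A n) := by
      rw [hμ, Measure.restrict_apply (hAm n)]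
      exact measure_mono fun x hx => ⟨hx.2, hx.1.1⟩
    calc Measure.hausdorffMeasure 1 (φ '' (E ∩ S ∩ A n))
        ≤ ((n + 2) * ε : ℝ≥0) * μ (A n) := h1.trans (by gcongr)
      _ = ∫⁻ x in A n, ((n + 2) * ε : ℝ≥0) ∂μ := by simp
      _ ≤ ∫⁻ x in A n, (G x + 2 * ε) ∂μ := by
          refine setLIntegral_mono' (hAm n) fun x hx => ?_
          have : (n + 2) * ε ≤ G x + 2 * ε := by
            rw [add_mul]; gcongr; exact (hle x hx).2
          exact_mod_cast this
  calc Measure.hausdorffMeasure 1 (φ '' E)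
      ≤ Measure.hausdorffMeasure 1 (⋃ n, φ '' (E ∩ S ∩ A n)) +
          Measure.hausdorffMeasure 1 (φ '' (E \ S)) :=
        (measure_mono hcover).trans (measure_union_le _ _)
    _ ≤ ∑' n, Measure.hausdorffMeasure 1 (φ '' (E ∩ S ∩ A n)) := by
        rw [hN, add_zero]; exact measure_iUnion_le _
    _ ≤ ∑' n, ∫⁻ x in A n, (G x + 2 * ε) ∂μ := ENNReal.tsum_le_tsum hpiece
    _ = ∫⁻ x, (G x + 2 * ε) ∂μ := by
        rw [← lintegral_iUnion hAm hAdisj, hAU, Measure.restrict_univ]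
    _ = ∫⁻ x, G x ∂μ + ε * (2 * μ univ) := by
        rw [lintegral_add_right _ measurable_const, lintegral_const]
        ring

end HausdorffImage

/-! ### Lipschitz parametrization of continua of finite length -/

section Parametrization

variable {X : Type*} [MetricSpace X]

/-- A finite set which cannot be split into two parts at distance more than `D` is traversed by a
walk with steps at most `D` and at most twice as many steps as there are points. -/
lemma exists_walk (S : Finset X) (hS : S.Nonempty) {D : ℝ} (hD : 0 ≤ D)
    (hconn : ∀ T ⊂ S, T.Nonempty → ∃ t ∈ T, ∃ s ∈ S, s ∉ T ∧ dist t s ≤ D) :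
    ∃ p : ℕ → X, (∀ i, p i ∈ S) ∧ (∀ i, dist (p i) (p (i + 1)) ≤ D) ∧
      ∀ s ∈ S, ∃ i ≤ 2 * S.card, p i = s := by
  classical
  suffices H : ∀ m : ℕ, m + 1 ≤ S.card → ∃ T ⊆ S, T.card = m + 1 ∧ ∃ p : ℕ → X, (∀ i, p i ∈ S) ∧
      (∀ i, dist (p i) (p (i + 1)) ≤ D) ∧ ∀ s ∈ T, ∃ i ≤ 2 * T.card, p i = s by
    have h0 := hS.card_pos
    obtain ⟨T, hTS, hT, p, hp⟩ := H (S.card - 1) (by omega)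
    obtain rfl : T = S := Finset.eq_of_subset_of_card_le hTS (by omega)
    exact ⟨p, hp⟩
  intro m
  induction m with
  | zero =>
    intro _
    obtain ⟨x, hx⟩ := hS
    exact ⟨{x}, by simpa using hx, by simp, fun _ => x, fun _ => hx, by simpa using hD,
      fun s hs => ⟨0, by simp, (Finset.mem_singleton.1 hs).symm⟩⟩
  | succ m ih =>
    intro hm
    obtain ⟨T, hTS, hT, p, hpS, hpD, hpT⟩ := ih (by omega)
    have hss : T ⊂ S := by
      refine hTS.ssubset_of_ne ?_
      rintro rfl
      omega
    obtain ⟨t, ht, s, hs, hsT, hd⟩ := hconn T hss (Finset.card_pos.1 (by omega))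
    obtain ⟨k, hk, rfl⟩ := hpT t ht
    -- The new point is visited by a detour `p k, s, p k`, after which the old walk resumes two
    -- steps late. Hence two steps per point.
    refine ⟨insert s T, Finset.insert_subset hs hTS, by
      rw [Finset.card_insert_of_notMem hsT, hT], fun i => if i ≤ k then p i else
        if i = k + 1 then s else p (i - 2), ?_, ?_, ?_⟩
    · intro i
      dsimp only
      split_ifs
      exacts [hpS _, hs, hpS _]
    · intro i
      rcases lt_trichotomy i k with h | h | h
      · simpa [h.le, Nat.succ_le_of_lt h] using hpD i
      · subst h
        simpa using hd
      · rcases eq_or_ne i (k + 1) with rfl | h'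
        · simpa [dist_comm] using hd
        · have h1 : ¬ i ≤ k := by omega
          have h2 : ¬ i + 1 ≤ k := by omega
          have h3 : i ≠ k := by omega
          have h4 := hpD (i - 2)
          have h5 : i - 2 + 1 = i + 1 - 2 := by omega
          rw [h5] at h4
          simpa [h1, h2, h3, h'] using h4
    · intro x hx
      rw [Finset.card_insert_of_notMem hsT]
      rcases Finset.mem_insert.1 hx with rfl | hx
      · exact ⟨k + 1, by omega, by simp⟩
      · obtain ⟨i, hi, rfl⟩ := hpT x hx
        by_cases h : i ≤ k
        · exact ⟨i, by omega, by simp [h]⟩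
        · refine ⟨i + 2, by omega, ?_⟩
          have h1 : ¬ i + 2 ≤ k := by omega
          have h2 : i + 2 ≠ k + 1 := by omega
          simp [h1, h2]

variable [MeasurableSpace X] [BorelSpace X]

/-- The cardinality of a separated subset of a continuum is controlled by the length. -/
lemma card_mul_le_of_separated {K : Set X} (hK : IsPreconnected K)
    (hfin : Measure.hausdorffMeasure 1 K ≠ ⊤) {x₀ y₀ : X} (hx₀ : x₀ ∈ K) (hy₀ : y₀ ∈ K) {δ : ℝ}
    (hδ : 0 < δ) (hδ' : δ ≤ dist x₀ y₀) {S : Finset X} (hSK : ↑S ⊆ K)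
    (hS : ∀ x ∈ S, ∀ y ∈ S, x ≠ y → δ ≤ dist x y) :
    S.card * (δ / 2) ≤ (Measure.hausdorffMeasure 1 K).toReal := by
  -- One of `x₀`, `y₀` is at distance at least `δ / 2` from `x`, so `K` leaves the ball.
  have hball : ∀ x ∈ S, ENNReal.ofReal (δ / 2) ≤
      (Measure.hausdorffMeasure 1).restrict K (Metric.ball x (δ / 2)) := by
    intro x hx
    rw [Measure.restrict_apply Metric.isOpen_ball.measurableSet, inter_comm]
    have h := dist_triangle_left x₀ y₀ x
    rw [dist_comm x x₀, dist_comm x y₀] at h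
    rcases le_total (δ / 2) (dist x₀ x) with h' | h'
    · exact ofReal_le_hausdorffMeasure_inter_ball hK (hSK hx) hx₀ h'
    · exact ofReal_le_hausdorffMeasure_inter_ball hK (hSK hx) hy₀ (by linarith)
  have hdisj : (S : Set X).PairwiseDisjoint fun x => Metric.ball x (δ / 2) := by
    intro x hx y hy hxy
    exact Metric.ball_disjoint_ball (by simpa using hS x hx y hy hxy)
  have h1 : (S.card : ℝ≥0∞) * ENNReal.ofReal (δ / 2) ≤ Measure.hausdorffMeasure 1 K := by
    calc (S.card : ℝ≥0∞) * ENNReal.ofReal (δ / 2)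
        = ∑ x ∈ S, ENNReal.ofReal (δ / 2) := by simp
      _ ≤ ∑ x ∈ S, (Measure.hausdorffMeasure 1).restrict K (Metric.ball x (δ / 2)) :=
          Finset.sum_le_sum hball
      _ = (Measure.hausdorffMeasure 1).restrict K (⋃ x ∈ S, Metric.ball x (δ / 2)) :=
          (measure_biUnion_finset hdisj fun x _ => Metric.isOpen_ball.measurableSet).symm
      _ ≤ Measure.hausdorffMeasure 1 K := by
          rw [← Measure.restrict_apply_univ K]; exact measure_mono (subset_univ _)
  have h2 := ENNReal.toReal_mono hfin h1
  rwa [ENNReal.toReal_mul, ENNReal.toReal_ofReal (by positivity), ENNReal.toReal_natCast] at h2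

/-- A continuum of finite length has finite nets of controlled cardinality. -/
lemma exists_separated_net {K : Set X} (hK : IsPreconnected K)
    (hfin : Measure.hausdorffMeasure 1 K ≠ ⊤) {x₀ y₀ : X} (hx₀ : x₀ ∈ K) (hy₀ : y₀ ∈ K) {δ : ℝ}
    (hδ : 0 < δ) (hδ' : δ ≤ dist x₀ y₀) :
    ∃ S : Finset X, ↑S ⊆ K ∧ (∀ x ∈ K, ∃ s ∈ S, dist x s ≤ δ) ∧
      S.card * (δ / 2) ≤ (Measure.hausdorffMeasure 1 K).toReal := by
  classical
  let P : ℕ → Prop := fun n => ∃ S : Finset X, S.card = n ∧ ↑S ⊆ K ∧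
    ∀ x ∈ S, ∀ y ∈ S, x ≠ y → δ ≤ dist x y
  have hbdd : BddAbove {n | P n} := by
    refine ⟨⌈(Measure.hausdorffMeasure 1 K).toReal / (δ / 2)⌉₊, ?_⟩
    rintro n ⟨S, rfl, hSK, hS⟩
    have h := card_mul_le_of_separated hK hfin hx₀ hy₀ hδ hδ' hSK hS
    rw [← le_div_iff₀ (by positivity)] at h
    exact_mod_cast h.trans (Nat.le_ceil _)
  -- A separated set of maximal cardinality is a net, since a point far from it could be added.
  obtain ⟨S, hcard, hSK, hS⟩ : P (sSup {n | P n}) :=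
    Nat.sSup_mem (s := {n | P n}) ⟨0, show P 0 from ⟨∅, by simp, by simp, by simp⟩⟩ hbdd
  refine ⟨S, hSK, ?_, card_mul_le_of_separated hK hfin hx₀ hy₀ hδ hδ' hSK hS⟩
  by_contra! hcon
  obtain ⟨x, hx, hxS⟩ := hcon
  have hxS' : x ∉ S := fun h => by have := hxS x h; rw [dist_self] at this; linarith
  have : P (S.card + 1) := by
    refine ⟨insert x S, Finset.card_insert_of_notMem hxS', ?_, ?_⟩
    · simpa [insert_subset_iff] using ⟨hx, hSK⟩
    · intro y hy z hz hyz
      rcases Finset.mem_insert.1 hy with hy | hy <;> rcases Finset.mem_insert.1 hz with hz | hz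
      · exact (hyz (hy.trans hz.symm)).elim
      · rw [hy]; exact (hxS z hz).le
      · rw [hz, dist_comm]; exact (hxS y hy).le
      · exact hS y hy z hz hyz
  have := le_csSup hbdd this
  omega

/-- A continuum of finite length is traversed up to an error `δ` by a map which is Lipschitz up to
the error `2 * δ`. -/
lemma exists_approx_parametrization {K : Set X} (hK : IsPreconnected K)
    (hfin : Measure.hausdorffMeasure 1 K ≠ ⊤) {x₀ y₀ : X} (hx₀ : x₀ ∈ K) (hy₀ : y₀ ∈ K) {δ : ℝ}
    (hδ : 0 < δ) (hδ' : δ ≤ dist x₀ y₀) :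
    ∃ g : ℝ → X, (∀ t, g t ∈ K) ∧
      (∀ s t, dist (g s) (g t) ≤ 8 * (Measure.hausdorffMeasure 1 K).toReal * |s - t| + 2 * δ) ∧
      ∀ x ∈ K, ∃ t ∈ Icc (0 : ℝ) 1, dist x (g t) ≤ δ := by
  obtain ⟨S, hSK, hnet, hcard⟩ := exists_separated_net hK hfin hx₀ hy₀ hδ hδ'
  set H := (Measure.hausdorffMeasure 1 K).toReal with hH
  have hSne : S.Nonempty := by
    obtain ⟨s, hs, -⟩ := hnet x₀ hx₀
    exact ⟨s, hs⟩
  obtain ⟨p, hpS, hpD, hp⟩ := exists_walk S hSne (D := 2 * δ) (by positivity) (by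
    intro T hT hTne
    have hcl : ∀ T : Finset X, IsClosed (⋃ t ∈ T, Metric.closedBall t δ) := fun T =>
      T.finite_toSet.isClosed_biUnion fun t _ => Metric.isClosed_closedBall
    obtain ⟨t₀, ht₀⟩ := hTne
    obtain ⟨s₀, hs₀, hs₀T⟩ := Finset.exists_of_ssubset hT
    classical
    -- The closed `δ`-neighbourhoods of `T` and `S \ T` cover the connected set `K`, so they meet on
    -- `K`. A common point gives a step of length at most `2 * δ`.
    obtain ⟨z, -, hz⟩ := isPreconnected_closed_iff.1 hK _ _ (hcl T) (hcl (S \ T)) (by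
        intro x hx
        obtain ⟨s, hs, hxs⟩ := hnet x hx
        by_cases h : s ∈ T
        · exact Or.inl (mem_biUnion h hxs)
        · exact Or.inr (mem_biUnion (Finset.mem_sdiff.2 ⟨hs, h⟩) hxs))
      ⟨t₀, hSK (hT.1 ht₀), mem_biUnion ht₀ (Metric.mem_closedBall_self hδ.le)⟩
      ⟨s₀, hSK hs₀, mem_biUnion (Finset.mem_sdiff.2 ⟨hs₀, hs₀T⟩) (Metric.mem_closedBall_self hδ.le)⟩
    simp only [mem_inter_iff, mem_iUnion, Metric.mem_closedBall, Finset.mem_sdiff] at hz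
    obtain ⟨⟨t, ht, hzt⟩, s, ⟨hs, hsT⟩, hzs⟩ := hz
    exact ⟨t, ht, s, hs, hsT, by linarith [dist_triangle_left t s z]⟩)
  have hsteps : ∀ m n : ℕ, dist (p m) (p n) ≤ 2 * δ * |(m : ℝ) - n| := by
    have key : ∀ m n : ℕ, m ≤ n → dist (p m) (p n) ≤ 2 * δ * |(m : ℝ) - n| := by
      intro m n hmn
      have h1 := dist_le_Ico_sum_of_dist_le hmn (d := fun _ => 2 * δ) (f := p)
        fun _ _ => hpD _
      rw [Finset.sum_const, Nat.card_Ico, nsmul_eq_mul, Nat.cast_sub hmn] at h1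
      have h2 : (m : ℝ) ≤ n := by exact_mod_cast hmn
      rw [abs_sub_comm, abs_of_nonneg (by linarith)]
      linarith
    intro m n
    rcases le_total m n with h | h
    · exact key m n h
    · rw [dist_comm, abs_sub_comm]; exact key n m h
  -- The walk is run at `M` steps per unit time. The speed is `2 * δ * M = 8 * (S.card * (δ / 2)) ≤
  -- 8 * H`, and rounding the time costs one further step, the error `2 * δ`.
  set M : ℝ := 2 * S.card with hM
  have hM0 : 0 < M := by have := hSne.card_pos; positivity
  have hMH : 2 * δ * M ≤ 8 * H := by rw [hM]; linarith
  let c : ℝ → ℝ := fun t => max 0 (min t 1)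
  have hc : ∀ s t, |c s - c t| ≤ |s - t| := by
    intro s t
    calc |c s - c t| ≤ |min s 1 - min t 1| := by
          simpa using abs_max_sub_max_le_abs (min s 1) (min t 1) (0 : ℝ) |>.trans_eq' (by
            simp only [c, max_comm])
      _ ≤ |s - t| := by simpa using abs_min_sub_min_le_max s 1 t 1
  refine ⟨fun t => p ⌊c t * M⌋₊, fun t => hSK (hpS _), ?_, ?_⟩
  · intro s t
    refine (hsteps _ _).trans ?_
    have hfl : ∀ t, c t * M - 1 < ⌊c t * M⌋₊ ∧ (⌊c t * M⌋₊ : ℝ) ≤ c t * M := fun t =>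
      ⟨Nat.sub_one_lt_floor _, Nat.floor_le (mul_nonneg (le_max_left _ _) hM0.le)⟩
    have h1 : |((⌊c s * M⌋₊ : ℕ) : ℝ) - (⌊c t * M⌋₊ : ℕ)| ≤ M * |s - t| + 1 := by
      have h2 : |c s * M - c t * M| ≤ M * |s - t| := by
        rw [← sub_mul, abs_mul, abs_of_pos hM0, mul_comm]
        exact mul_le_mul_of_nonneg_left (hc s t) hM0.le
      have h3 := abs_le.1 h2
      rw [abs_le]
      constructor <;> linarith [(hfl s).1, (hfl s).2, (hfl t).1, (hfl t).2]
    calc 2 * δ * |((⌊c s * M⌋₊ : ℕ) : ℝ) - (⌊c t * M⌋₊ : ℕ)| ≤ 2 * δ * (M * |s - t| + 1) := by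
          gcongr
      _ = 2 * δ * M * |s - t| + 2 * δ := by ring
      _ ≤ 8 * H * |s - t| + 2 * δ := by gcongr
  · intro x hx
    obtain ⟨s, hs, hxs⟩ := hnet x hx
    obtain ⟨i, hi, rfl⟩ := hp s hs
    have hi' : (i : ℝ) ≤ M := by rw [hM]; exact_mod_cast hi
    have h1 : (i : ℝ) / M ≤ 1 := (div_le_one hM0).2 hi'
    have h0 : 0 ≤ (i : ℝ) / M := by positivity
    refine ⟨i / M, ⟨h0, h1⟩, ?_⟩
    have : c (i / M) * M = i := by
      simp only [c, min_eq_left h1, max_eq_right h0]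
      field_simp
    simpa [this] using hxs

/-- **Ważewski's theorem**: a continuum of finite length is a Lipschitz image of an interval. -/
theorem exists_lipschitz_parametrization {K : Set X} (hKc : IsCompact K) (hK : IsConnected K)
    (hfin : Measure.hausdorffMeasure 1 K ≠ ⊤) :
    ∃ (L : ℝ≥0) (f : ℝ → X), LipschitzWith L f ∧ f '' Icc 0 1 = K := by
  obtain ⟨x₀, hx₀⟩ := hK.nonempty
  by_cases hsub : ∀ y ∈ K, y = x₀
  · refine ⟨0, fun _ => x₀, LipschitzWith.const x₀, ?_⟩
    rw [(nonempty_Icc.2 zero_le_one).image_const]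
    exact Subset.antisymm (singleton_subset_iff.2 hx₀) fun y hy => hsub y hy
  push Not at hsub
  obtain ⟨y₀, hy₀, hne⟩ := hsub
  have hd : 0 < dist x₀ y₀ := dist_pos.2 hne.symm
  set δ : ℕ → ℝ := fun k => dist x₀ y₀ / ((k : ℝ) + 1) with hδdef
  have hδ : ∀ k, 0 < δ k := fun k => by positivity
  have hδ' : ∀ k, δ k ≤ dist x₀ y₀ := fun k => div_le_self hd.le (by linarith [k.cast_nonneg (α := ℝ)])
  have hδ0 : Tendsto δ (hyperfilter ℕ) (𝓝 0) :=
    (tendsto_const_nhds.div_atTop (tendsto_atTop_add_const_right _ _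
      tendsto_natCast_atTop_atTop)).mono_left Nat.hyperfilter_le_atTop
  choose g hgK hgL hgnet using fun k =>
    exists_approx_parametrization hK.isPreconnected hfin hx₀ hy₀ (hδ k) (hδ' k)
  set H := (Measure.hausdorffMeasure 1 K).toReal with hH
  -- Along an ultrafilter the limit exists at every parameter at once by compactness of `K`. The
  -- approximants may be discontinuous, but their error `2 * δ k` vanishes in the limit.
  have hlim : ∀ t, ∃ z ∈ K, Tendsto (fun k => g k t) (hyperfilter ℕ) (𝓝 z) := by
    intro t
    obtain ⟨z, hz, hzt⟩ := hKc.ultrafilter_le_nhds ((hyperfilter ℕ).map fun k => g k t)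
      (le_principal_iff.2 (Filter.mem_map.2 (Filter.univ_mem' fun k => hgK k t)))
    exact ⟨z, hz, hzt⟩
  choose f hfK hf using hlim
  have hfL : LipschitzWith (Real.toNNReal (8 * H)) f := by
    refine LipschitzWith.of_dist_le_mul fun s t => ?_
    rw [Real.coe_toNNReal _ (by positivity), Real.dist_eq]
    have h1 := ((hf s).dist (hf t))
    have h2 : Tendsto (fun k => 8 * H * |s - t| + 2 * δ k) (hyperfilter ℕ)
        (𝓝 (8 * H * |s - t| + 2 * 0)) := tendsto_const_nhds.add (hδ0.const_mul 2)
    simpa using le_of_tendsto_of_tendsto' h1 h2 fun k => hgL k s t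
  refine ⟨_, f, hfL, Subset.antisymm (image_subset_iff.2 fun t _ => hfK t) fun x hx => ?_⟩
  choose t ht hxt using fun k => hgnet k x hx
  obtain ⟨s, hs, hst⟩ := isCompact_Icc.ultrafilter_le_nhds ((hyperfilter ℕ).map t)
      (le_principal_iff.2 (Filter.mem_map.2 (Filter.univ_mem' ht)))
  have hst' : Tendsto t (hyperfilter ℕ) (𝓝 s) := hst
  refine ⟨s, hs, tendsto_nhds_unique (hf s) ?_⟩
  rw [tendsto_iff_dist_tendsto_zero]
  have h2 : Tendsto (fun k => (8 * H * |s - t k| + 2 * δ k) + δ k) (hyperfilter ℕ)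
      (𝓝 ((8 * H * |s - s| + 2 * 0) + 0)) :=
    ((((tendsto_const_nhds.sub hst').abs).const_mul _).add (hδ0.const_mul 2)).add hδ0
  refine squeeze_zero (fun _ => dist_nonneg) (fun k => ?_) (by simpa using h2)
  have h3 := dist_triangle_right (g k s) x (g k (t k))
  linarith [hgL k s (t k), hxt k]

end Parametrization

/-! ### Regular points and the approximate tangent line -/

section Tangent

/-- The curve `f : [0, 1] → ℝ²` passes through `x` only with nonzero velocities parallel to the
unit vector `v`, and does not end there. -/
structure IsRegularPoint (f : ℝ → Plane) (x v : Plane) : Prop where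
  norm_eq_one : ‖v‖ = 1
  hasDerivAt : ∀ t ∈ Icc (0 : ℝ) 1, f t = x → t < 1 ∧ ∃ c : ℝ, c ≠ 0 ∧ HasDerivAt f (c • v) t

variable {f : ℝ → Plane} {L : ℝ≥0}

lemma IsRegularPoint.neg {x v : Plane} (h : IsRegularPoint f x v) : IsRegularPoint f x (-v) :=
  ⟨by rw [norm_neg, h.norm_eq_one], fun t ht htx => by
    obtain ⟨h1, c, hc, hd⟩ := h.hasDerivAt t ht htx
    exact ⟨h1, -c, neg_ne_zero.2 hc, by rwa [neg_smul_neg]⟩⟩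

/-- The parameters at which a Lipschitz curve is stationary or not differentiable, and the final
parameter, are mapped to a set of length zero. -/
lemma hausdorffMeasure_image_degenerate (hf : LipschitzWith L f) :
    Measure.hausdorffMeasure 1
      (f '' {t ∈ Icc (0 : ℝ) 1 | ¬ (t < 1 ∧ ∃ a, a ≠ 0 ∧ HasDerivAt f a t)}) = 0 := by
  have hsub : {t ∈ Icc (0 : ℝ) 1 | ¬ (t < 1 ∧ ∃ a, a ≠ 0 ∧ HasDerivAt f a t)} ⊆
      ({t | ¬ DifferentiableAt ℝ f t} ∪ {1}) ∪ {t ∈ Icc (0 : ℝ) 1 | HasDerivAt f 0 t} := by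
    rintro t ⟨ht, h⟩
    by_cases hd : DifferentiableAt ℝ f t
    · rcases ht.2.eq_or_lt with rfl | h1
      · exact Or.inl (Or.inr rfl)
      · have h0 : deriv f t = 0 := by
          by_contra h0
          exact h ⟨h1, _, h0, hd.hasDerivAt⟩
        exact Or.inr ⟨ht, by simpa [h0] using hd.hasDerivAt⟩
    · exact Or.inl (Or.inl hd)
  refine measure_mono_null (image_mono hsub) ?_
  rw [image_union, measure_union_null_iff]
  constructor
  · have h1 : volume ({t | ¬ DifferentiableAt ℝ f t} ∪ {(1 : ℝ)}) = 0 := by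
      rw [measure_union_null_iff]
      exact ⟨hf.ae_differentiableAt_real, measure_singleton _⟩
    have h2 := hf.hausdorffMeasure_image_le (zero_le_one (α := ℝ))
      ({t | ¬ DifferentiableAt ℝ f t} ∪ {(1 : ℝ)})
    rw [hausdorffMeasure_real, h1, mul_zero] at h2
    exact nonpos_iff_eq_zero.1 h2
  -- At a stationary parameter the pointwise Lipschitz constant is at most `ε` for every `ε > 0`.
  · refine nonpos_iff_eq_zero.1 (ENNReal.le_of_forall_pos_le_add fun ε hε _ => ?_)
    have h1 : Measure.hausdorffMeasure 1 (f '' {t ∈ Icc (0 : ℝ) 1 | HasDerivAt f 0 t}) ≤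
        ε * Measure.hausdorffMeasure 1 {t ∈ Icc (0 : ℝ) 1 | HasDerivAt f 0 t} := by
      refine hausdorffMeasure_image_le_of_eventually fun t ht => ?_
      have h2 := (ht.2.isLittleO.bound (show (0 : ℝ) < ε from hε)).filter_mono
        (nhdsWithin_le_nhds (s := {t ∈ Icc (0 : ℝ) 1 | HasDerivAt f 0 t}))
      refine h2.mono fun s hs => ?_
      rw [dist_comm (f t), dist_comm t, dist_eq_norm, dist_eq_norm]
      simpa using hs
    rw [zero_add]
    refine h1.trans ?_
    calc (ε : ℝ≥0∞) * Measure.hausdorffMeasure 1 {t ∈ Icc (0 : ℝ) 1 | HasDerivAt f 0 t}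
        ≤ ε * Measure.hausdorffMeasure 1 (Icc (0 : ℝ) 1) := by
          gcongr
          exact fun t ht => ht.1
      _ = ε := by rw [hausdorffMeasure_real]; simp

/-- A plane curve crosses itself transversally in at most countably many points. -/
lemma countable_transversal (f : ℝ → Plane) :
    {x | ∃ s t a b, f s = x ∧ f t = x ∧ HasDerivAt f a s ∧ HasDerivAt f b t ∧
      LinearIndependent ℝ ![a, b]}.Countable := by
  let Z : Set (ℝ × ℝ) := {z | f z.1 = f z.2 ∧ ∃ a b, HasDerivAt f a z.1 ∧ HasDerivAt f b z.2 ∧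
    LinearIndependent ℝ ![a, b]}
  have hZ : Z.Countable := by
    -- At such a pair the derivative of `(s, t) ↦ f s - f t` is injective, so the zero is isolated.
    -- A discrete subset of `ℝ × ℝ` is countable.
    have : DiscreteTopology Z := by
      rw [discreteTopology_subtype_iff]
      rintro z ⟨-, a, b, ha, hb, hab⟩
      rw [← disjoint_iff, disjoint_principal_right]
      have h1 : HasFDerivAt (fun w : ℝ × ℝ => f w.1 - f w.2)
          ((ContinuousLinearMap.toSpanSingleton ℝ a).comp (ContinuousLinearMap.fst ℝ ℝ ℝ) -
            (ContinuousLinearMap.toSpanSingleton ℝ b).comp (ContinuousLinearMap.snd ℝ ℝ ℝ)) z :=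
        (ha.hasFDerivAt.comp z hasFDerivAt_fst).sub (hb.hasFDerivAt.comp z hasFDerivAt_snd)
      have h2 := h1.eventually_ne (c := 0) (by
        obtain ⟨C, -, hC⟩ := LinearMap.exists_antilipschitzWith
          (((ContinuousLinearMap.toSpanSingleton ℝ a).comp (ContinuousLinearMap.fst ℝ ℝ ℝ) -
            (ContinuousLinearMap.toSpanSingleton ℝ b).comp
              (ContinuousLinearMap.snd ℝ ℝ ℝ) : ℝ × ℝ →L[ℝ] Plane) : ℝ × ℝ →ₗ[ℝ] Plane) (by
            rw [LinearMap.ker_eq_bot']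
            rintro ⟨p, q⟩ hpq
            have hpq' : p • a + (-q) • b = 0 := by simpa [sub_eq_add_neg] using hpq
            obtain ⟨h3, h4⟩ := LinearIndependent.pair_iff.1 hab _ _ hpq'
            simp [h3, neg_eq_zero.1 h4])
        exact ⟨C, hC⟩)
      filter_upwards [h2] with w hw hwZ
      exact hw (sub_eq_zero.2 hwZ.1)
    exact TopologicalSpace.separableSpace_iff_countable.1 inferInstance
  refine (hZ.image fun z => f z.1).mono ?_
  rintro x ⟨s, t, a, b, hs, ht, ha, hb, hab⟩
  exact ⟨(s, t), ⟨hs.trans ht.symm, a, b, ha, hb, hab⟩, hs⟩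

/-- Almost every point of a Lipschitz curve is regular. -/
lemma ae_exists_isRegularPoint {K : Set Plane} (hK : MeasurableSet K) (hf : LipschitzWith L f)
    (hfK : f '' Icc 0 1 = K) :
    ∀ᵐ x ∂length K, x ∈ K ∧ ∃ v, IsRegularPoint f x v := by
  have h1 : ∀ᵐ x ∂length K,
      x ∉ f '' {t ∈ Icc (0 : ℝ) 1 | ¬ (t < 1 ∧ ∃ a, a ≠ 0 ∧ HasDerivAt f a t)} :=
    measure_eq_zero_iff_ae_notMem.1 (nonpos_iff_eq_zero.1
      ((Measure.restrict_apply_le _ _).trans_eq (hausdorffMeasure_image_degenerate hf)))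
  have h2 : ∀ᵐ x ∂length K, x ∉ {x | ∃ s t a b, f s = x ∧ f t = x ∧ HasDerivAt f a s ∧
      HasDerivAt f b t ∧ LinearIndependent ℝ ![a, b]} := by
    have := Measure.nullSingletonClass_hausdorff Plane one_pos
    exact measure_eq_zero_iff_ae_notMem.1 (nonpos_iff_eq_zero.1
      ((Measure.restrict_apply_le _ _).trans_eq ((countable_transversal f).measure_zero _)))
  filter_upwards [h1, h2, ae_restrict_mem hK] with x hx1 hx2 hxK
  have hreg : ∀ t ∈ Icc (0 : ℝ) 1, f t = x → t < 1 ∧ ∃ a, a ≠ 0 ∧ HasDerivAt f a t := by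
    intro t ht htx
    by_contra hcon
    exact hx1 ⟨t, ⟨ht, hcon⟩, htx⟩
  obtain ⟨t₀, ht₀, htx₀⟩ := hfK.symm ▸ hxK
  obtain ⟨-, a₀, ha₀, hd₀⟩ := hreg t₀ ht₀ htx₀
  refine ⟨hxK, ‖a₀‖⁻¹ • a₀, norm_smul_inv_norm ha₀, fun t ht htx => ?_⟩
  obtain ⟨ht1, a, ha, hd⟩ := hreg t ht htx
  have hdep : ¬ LinearIndependent ℝ ![a₀, a] := fun h => hx2 ⟨t₀, t, a₀, a, htx₀, htx, hd₀, hd, h⟩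
  rw [LinearIndependent.pair_iff' ha₀] at hdep
  push Not at hdep
  obtain ⟨c, rfl⟩ := hdep
  have hc : c ≠ 0 := by rintro rfl; simp at ha
  have hn : ‖a₀‖ ≠ 0 := norm_ne_zero_iff.2 ha₀
  exact ⟨ht1, c * ‖a₀‖, mul_ne_zero hc hn, by rwa [smul_smul, mul_assoc, mul_inv_cancel₀ hn, mul_one]⟩

/-- Near a regular point the curve lies in every two-sided cone about the tangent. -/
lemma IsRegularPoint.eventually_cone {x v : Plane} (h : IsRegularPoint f x v)
    (hf : Continuous f) {ε : ℝ} (hε : 0 < ε) :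
    ∀ᶠ y in 𝓝[f '' Icc 0 1] x, ∃ c : ℝ, ‖y - x - c • v‖ ≤ ε * ‖y - x‖ := by
  -- Compactness of `[0, 1]` reduces the claim to one parameter `t`: if `f t = x` the first-order
  -- expansion applies, otherwise nearby parameters stay away from `x`.
  refine isCompact_Icc.induction_on
    (p := fun S => ∀ᶠ y in 𝓝[f '' S] x, ∃ c : ℝ, ‖y - x - c • v‖ ≤ ε * ‖y - x‖) (by simp)
    (fun S T hST hT => hT.filter_mono (nhdsWithin_mono _ (image_mono hST)))
    (fun S T hS hT => by rw [image_union, nhdsWithin_union]; exact eventually_sup.2 ⟨hS, hT⟩)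
    fun t ht => ?_
  by_cases htx : f t = x
  · obtain ⟨-, c, hc, hd⟩ := h.hasDerivAt t ht htx
    -- Chosen so that `|s - t| * (|c| - η) ≤ ‖f s - x‖` implies `η * |s - t| ≤ ε * ‖f s - x‖`.
    set η : ℝ := ε * |c| / (1 + ε) with hη
    have hη0 : 0 < η := by positivity
    refine ⟨_, nhdsWithin_le_nhds (hd.isLittleO.bound hη0), ?_⟩
    refine eventually_mem_nhdsWithin.mono ?_
    rintro _ ⟨s, hs, rfl⟩
    refine ⟨(s - t) * c, ?_⟩
    simp only [mem_ofPred_eq, htx, smul_smul, Real.norm_eq_abs] at hs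
    have h1 : |s - t| * |c| ≤ ‖f s - x‖ + η * |s - t| := by
      have h2 := norm_le_norm_add_norm_sub' (((s - t) * c) • v) (f s - x)
      rw [norm_smul, h.norm_eq_one, mul_one, Real.norm_eq_abs, abs_mul] at h2
      rw [norm_sub_rev] at hs
      linarith
    refine hs.trans ?_
    have h3 : η * (1 + ε) = ε * |c| := by rw [hη]; field_simp
    nlinarith [abs_nonneg (s - t)]
  · obtain ⟨U, hU, V, hV, hUV⟩ := Filter.disjoint_iff.1 (disjoint_nhds_nhds.2 htx)
    refine ⟨f ⁻¹' U, nhdsWithin_le_nhds (hf.continuousAt hU), ?_⟩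
    filter_upwards [eventually_mem_nhdsWithin, nhdsWithin_le_nhds hV] with y hy hyV
    obtain ⟨s, hs, rfl⟩ := hy
    exact (Set.disjoint_left.1 hUV hs hyV).elim

/-- The upper density of the curve at a regular point is finite. -/
lemma IsRegularPoint.exists_density_le {x v : Plane} (h : IsRegularPoint f x v)
    (hf : LipschitzWith L f) :
    ∃ M : ℝ≥0, ∀ᶠ r in 𝓝[>] (0 : ℝ),
      length (f '' Icc 0 1) (Metric.closedBall x r) ≤ M * ENNReal.ofReal r := by
  suffices H : ∃ M : ℝ≥0, ∀ᶠ r in 𝓝[>] (0 : ℝ),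
      Measure.hausdorffMeasure 1 (Metric.closedBall x r ∩ f '' Icc 0 1) ≤ M * ENNReal.ofReal r by
    obtain ⟨M, hM⟩ := H
    refine ⟨M, hM.mono fun r hr => ?_⟩
    rwa [length, Measure.restrict_apply Metric.isClosed_closedBall.measurableSet]
  refine isCompact_Icc.induction_on (p := fun S => ∃ M : ℝ≥0, ∀ᶠ r in 𝓝[>] (0 : ℝ),
      Measure.hausdorffMeasure 1 (Metric.closedBall x r ∩ f '' S) ≤ M * ENNReal.ofReal r)
    ⟨0, by simp⟩ ?_ ?_ fun t ht => ?_
  · rintro S T hST ⟨M, hM⟩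
    refine ⟨M, hM.mono fun r hr => (measure_mono ?_).trans hr⟩
    gcongr
  · rintro S T ⟨M, hM⟩ ⟨N, hN⟩
    refine ⟨M + N, (hM.and hN).mono fun r hr => ?_⟩
    rw [image_union, inter_union_distrib_left, ENNReal.coe_add, add_mul]
    exact (measure_union_le _ _).trans (add_le_add hr.1 hr.2)
  by_cases htx : f t = x
  · obtain ⟨-, c, hc, hd⟩ := h.hasDerivAt t ht htx
    have hc0 : 0 < |c| := abs_pos.2 hc
    refine ⟨_, nhdsWithin_le_nhds (hd.isLittleO.bound (half_pos hc0)),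
      L * Real.toNNReal (2 * (2 / |c|)), ?_⟩
    refine eventually_mem_nhdsWithin.mono fun r hr => ?_
    -- Near `t` the curve leaves `x` at speed at least `|c| / 2`, so only parameters within `2 / |c|
    -- * r` of `t` can reach the ball.
    have hsub : Metric.closedBall x r ∩ f '' {s | ‖f s - f t - (s - t) • c • v‖ ≤
        |c| / 2 * ‖s - t‖} ⊆ f '' Metric.closedBall t (2 / |c| * r) := by
      rintro _ ⟨hr, s, hs, rfl⟩
      refine ⟨s, ?_, rfl⟩
      simp only [mem_ofPred_eq, htx, smul_smul, Real.norm_eq_abs] at hs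
      rw [Metric.mem_closedBall, dist_eq_norm] at hr
      have h2 := norm_le_norm_add_norm_sub' (((s - t) * c) • v) (f s - x)
      rw [norm_smul, h.norm_eq_one, mul_one, Real.norm_eq_abs, abs_mul] at h2
      rw [norm_sub_rev] at hs
      rw [Metric.mem_closedBall, Real.dist_eq, div_mul_eq_mul_div, le_div_iff₀ hc0]
      linarith
    refine (measure_mono hsub).trans ((hf.hausdorffMeasure_image_le (zero_le_one (α := ℝ)) _).trans
      ?_)
    have hr0 : 0 < r := hr
    rw [hausdorffMeasure_real, Real.volume_closedBall, ← mul_assoc, ENNReal.ofReal_mul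
      (by positivity), ENNReal.coe_mul, ENNReal.rpow_one, mul_assoc]
    rfl
  · obtain ⟨U, hU, V, hV, hUV⟩ := Filter.disjoint_iff.1 (disjoint_nhds_nhds.2 htx)
    refine ⟨f ⁻¹' U, nhdsWithin_le_nhds (hf.continuous.continuousAt hU), 0, ?_⟩
    obtain ⟨δ, hδ, hδV⟩ := Metric.nhds_basis_closedBall.mem_iff.1 hV
    filter_upwards [nhdsWithin_le_nhds (Iic_mem_nhds hδ)] with r hr
    have : Metric.closedBall x r ∩ f '' (f ⁻¹' U) = ∅ := by
      refine eq_empty_of_forall_notMem ?_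
      rintro _ ⟨hy, s, hs, rfl⟩
      exact Set.disjoint_left.1 hUV hs (hδV (Metric.closedBall_subset_closedBall hr hy))
    simp [this]

/-- A connected set of positive length has lower density at least `1 / 2` at each of its points. -/
lemma eventually_ofReal_le_length {K : Set Plane} (hK : IsPreconnected K) (hK0 : length K ≠ 0)
    {x : Plane} (hx : x ∈ K) :
    ∀ᶠ r in 𝓝[>] (0 : ℝ), ENNReal.ofReal r ≤ length K (Metric.ball x r) := by
  have : ∃ y ∈ K, y ≠ x := by
    by_contra! hcon
    refine hK0 ?_
    have := Measure.nullSingletonClass_hausdorff Plane one_pos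
    rw [length, Measure.restrict_eq_zero]
    exact (subsingleton_of_forall_eq x hcon).measure_zero _
  obtain ⟨y, hy, hyx⟩ := this
  filter_upwards [nhdsWithin_le_nhds (Iic_mem_nhds (dist_pos.2 hyx))] with r hr
  rw [length, Measure.restrict_apply Metric.isOpen_ball.measurableSet, inter_comm]
  exact ofReal_le_hausdorffMeasure_inter_ball hK hx hy hr

/-- The density is bounded below by connectedness. Near `x` the set `K` lies in the cone of aperture
`s / 2`, so it meets the complement of the cone of aperture `s` at most in `x`. -/
lemma IsRegularPoint.isApproxTangentLine {K : Set Plane} (hKm : MeasurableSet K)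
    (hK : IsPreconnected K) (hK0 : length K ≠ 0) (hf : Continuous f) (hfK : f '' Icc 0 1 = K)
    {x v : Plane} (h : IsRegularPoint f x v) (hx : x ∈ K) :
    IsApproxTangentLine K x (Submodule.span ℝ {v}) := by
  refine ⟨finrank_span_singleton (norm_ne_zero_iff.1 (by rw [h.norm_eq_one]; exact one_ne_zero)),
    ?_, fun s hs hs1 => ?_⟩
  · refine (show (0 : ℝ≥0∞) < 2⁻¹ by simp).trans_le ?_
    refine le_limsup_of_frequently_le (Eventually.frequently ?_)
    filter_upwards [eventually_ofReal_le_length hK hK0 hx, eventually_mem_nhdsWithin] with r hr hr0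
    have hr0' : 0 < r := hr0
    rw [ENNReal.le_div_iff_mul_le (by simp [hr0']) (Or.inl ENNReal.ofReal_ne_top), ENNReal.ofReal_mul (by norm_num),
      ENNReal.ofReal_ofNat, ← mul_assoc, ENNReal.inv_mul_cancel (by simp) (by simp), one_mul]
    exact hr.trans (measure_mono Metric.ball_subset_closedBall)
  · refine tendsto_const_nhds.congr' ?_
    have h1 := h.eventually_cone hf (half_pos hs)
    rw [hfK, eventually_nhdsWithin_iff, Metric.nhds_basis_closedBall.eventually_iff] at h1
    obtain ⟨δ, hδ, h1⟩ := h1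
    filter_upwards [nhdsWithin_le_nhds (Iic_mem_nhds hδ)] with r hr
    have h2 : (Metric.closedBall x r ∩ coneCompl x (Submodule.span ℝ {v}) s) ∩ K ⊆ {x} := by
      rintro y ⟨⟨hyr, hys⟩, hyK⟩
      obtain ⟨c, hc⟩ := h1 (Metric.closedBall_subset_closedBall hr hyr) hyK
      have h3 : Metric.infDist (y - x) (Submodule.span ℝ {v} : Set Plane) ≤ ‖y - x - c • v‖ := by
        rw [← dist_eq_norm]
        exact Metric.infDist_le_dist_of_mem (Submodule.mem_span_singleton.2 ⟨c, rfl⟩)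
      have h4 : s * ‖y - x‖ ≤ _ := hys
      have h5 : ‖y - x‖ = 0 := by nlinarith [norm_nonneg (y - x)]
      exact sub_eq_zero.1 (norm_eq_zero.1 h5)
    have := Measure.nullSingletonClass_hausdorff Plane one_pos
    rw [length, Measure.restrict_apply' hKm, measure_mono_null h2 (measure_singleton _),
      ENNReal.zero_div]

/-- At a regular point the approximate tangent line is unique. -/
lemma IsRegularPoint.mem_span_of_isApproxTangentLine {K : Set Plane} (hKm : MeasurableSet K)
    (hf : Continuous f) (hfK : f '' Icc 0 1 = K)
    {x v w : Plane} (h : IsRegularPoint f x v)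
    (hw : IsApproxTangentLine K x (Submodule.span ℝ {w})) :
    v ∈ Submodule.span ℝ {w} := by
  set W : Submodule ℝ Plane := Submodule.span ℝ {w} with hW
  by_contra hv
  set d := Metric.infDist v (W : Set Plane) with hd
  have hWne : (W : Set Plane).Nonempty := ⟨0, W.zero_mem⟩
  have hd0 : 0 < d :=
    ((W.closed_of_finiteDimensional).notMem_iff_infDist_pos hWne).1 hv
  have hd1 : d ≤ 1 := by
    have := Metric.infDist_le_dist_of_mem (x := v) W.zero_mem
    rwa [dist_zero_right, h.norm_eq_one] at this
  have hscale : ∀ c : ℝ, ∀ l ∈ W, |c| * d ≤ ‖c • v - l‖ := by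
    intro c l hl
    rcases eq_or_ne c 0 with rfl | hc
    · simp
    · have h1 : d ≤ ‖v - c⁻¹ • l‖ := by
        rw [← dist_eq_norm]
        exact Metric.infDist_le_dist_of_mem (W.smul_mem _ hl)
      calc |c| * d ≤ |c| * ‖v - c⁻¹ • l‖ := by gcongr
        _ = ‖c • v - l‖ := by
          rw [← Real.norm_eq_abs, ← norm_smul, smul_sub, smul_inv_smul₀ hc]
  -- If `v` has distance `d > 0` from `W`, the cone of aperture `d / 4` about `v` lies outside the
  -- cone of aperture `d / 2` about `W`, because `d - d ^ 2 / 4 - d / 4 ≥ d / 2` for `d ≤ 1`. Near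
  -- `x` all of `K` would then have density zero.
  have hlim := hw.density_coneCompl (d / 2) (by positivity) (by linarith)
  have h1 := h.eventually_cone hf (show 0 < d / 4 by positivity)
  rw [hfK, eventually_nhdsWithin_iff, Metric.nhds_basis_closedBall.eventually_iff] at h1
  obtain ⟨δ, hδ, h1⟩ := h1
  have h2 : Tendsto (fun r : ℝ => length K (Metric.closedBall x r) / ENNReal.ofReal (2 * r))
      (𝓝[>] 0) (𝓝 0) := by
    refine hlim.congr' ?_
    filter_upwards [nhdsWithin_le_nhds (Iic_mem_nhds hδ)] with r hr
    congr 1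
    rw [length, Measure.restrict_apply' hKm, Measure.restrict_apply' hKm]
    congr 1
    refine Subset.antisymm (by gcongr; exact inter_subset_left) fun y hy => ⟨⟨hy.1, ?_⟩, hy.2⟩
    obtain ⟨c, hc⟩ := h1 (Metric.closedBall_subset_closedBall hr hy.1) hy.2
    have h3 : ‖y - x‖ ≤ |c| + d / 4 * ‖y - x‖ := by
      have := norm_le_norm_add_norm_sub' (y - x) (c • v)
      rw [norm_smul, h.norm_eq_one, mul_one, Real.norm_eq_abs] at this
      linarith
    refine (Metric.le_infDist hWne).2 fun l hl => ?_
    rw [dist_eq_norm]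
    have h4 := hscale c l hl
    have h5 : ‖c • v - l‖ ≤ ‖y - x - c • v‖ + ‖y - x - l‖ := by
      have := norm_sub_le (y - x - l) (y - x - c • v)
      rw [show y - x - l - (y - x - c • v) = c • v - l by abel] at this
      linarith
    have h6 := mul_le_mul_of_nonneg_right h3 hd0.le
    have h7 := mul_nonneg (mul_nonneg hd0.le (sub_nonneg.2 hd1)) (norm_nonneg (y - x))
    linarith
  have h3 := hw.upperDensity_pos
  rw [h2.limsup_eq] at h3
  exact lt_irrefl _ h3

/-- Almost every point of a continuum of finite length is regular, with velocities parallel to the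
unit tangent. -/
theorem ae_isRegularPoint_unitTangent {K : Set Plane} (hKm : MeasurableSet K)
    (hK : IsPreconnected K) (hf : LipschitzWith L f) (hfK : f '' Icc 0 1 = K) :
    ∀ᵐ x ∂length K, x ∈ K ∧ IsRegularPoint f x (unitTangent K x) := by
  by_cases hK0 : length K = 0
  · simp [hK0]
  filter_upwards [ae_exists_isRegularPoint hKm hf hfK] with x ⟨hxK, v, hv⟩
  refine ⟨hxK, ?_⟩
  have hex : ∃ v : Plane, ‖v‖ = 1 ∧ IsApproxTangentLine K x (Submodule.span ℝ {v}) :=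
    ⟨v, hv.norm_eq_one, hv.isApproxTangentLine hKm hK hK0 hf.continuous hfK hxK⟩
  have hτ : unitTangent K x = hex.choose := by rw [unitTangent, dif_pos hex]
  obtain ⟨hn, hT⟩ := hex.choose_spec
  rw [← hτ] at hn hT
  obtain ⟨c, hc⟩ := Submodule.mem_span_singleton.1
    (hv.mem_span_of_isApproxTangentLine hKm hf.continuous hfK hT)
  have hc1 : |c| = 1 := by
    have := congrArg norm hc
    rwa [norm_smul, hn, mul_one, hv.norm_eq_one] at this
  rcases (abs_eq zero_le_one).1 hc1 with rfl | rfl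
  · rw [one_smul] at hc
    rwa [hc]
  · rw [neg_one_smul] at hc
    have := hv.neg
    rwa [← hc, neg_neg] at this

end Tangent

/-! ### Oscillation and sup bounds for smooth functions -/

section SmoothPair

variable {K : Set Plane} {f : ℝ → Plane} {L : ℝ≥0}

/-- The pair `p` consists of the restriction to `K` of the smooth function `φ` and of its tangential
gradient. -/
structure IsSmoothPair (K : Set Plane) (p : WithLp 2 (L2 K × L2Vec K)) (φ : Plane → ℝ) : Prop where
  contDiff : ContDiff ℝ ∞ φ
  fst_ae_eq : p.fst =ᵐ[length K] φ
  snd_ae_eq : p.snd =ᵐ[length K] tangentialGradient K φ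

lemma IsSmoothPair.sub {p q : WithLp 2 (L2 K × L2Vec K)} {φ ψ : Plane → ℝ}
    (hp : IsSmoothPair K p φ) (hq : IsSmoothPair K q ψ) : IsSmoothPair K (p - q) (φ - ψ) := by
  refine ⟨hp.contDiff.sub hq.contDiff, ?_, ?_⟩
  · rw [WithLp.sub_fst]
    exact (Lp.coeFn_sub _ _).trans (hp.fst_ae_eq.sub hq.fst_ae_eq)
  · rw [WithLp.sub_snd]
    refine ((Lp.coeFn_sub _ _).trans (hp.snd_ae_eq.sub hq.snd_ae_eq)).trans
      (Eventually.of_forall fun x => ?_)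
    have h1 : φ - ψ = φ + (-1 : ℝ) • ψ := by rw [neg_one_smul, sub_eq_add_neg]
    rw [h1, tangentialGradient_add K hp.contDiff (show ContDiff ℝ ∞ ((-1 : ℝ) • ψ) from
      hq.contDiff.const_smul (-1 : ℝ)), tangentialGradient_smul K _ hq.contDiff, neg_one_smul, ← sub_eq_add_neg]
    rfl

lemma norm_tangentialGradient {x : Plane} (h : ‖unitTangent K x‖ = 1) (φ : Plane → ℝ) :
    ‖tangentialGradient K φ x‖ = |⟪gradient φ x, unitTangent K x⟫| := by
  rw [tangentialGradient, norm_smul, h, mul_one, Real.norm_eq_abs]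

/-- At a regular point the pointwise Lipschitz constant of a differentiable function along the curve
is its tangential derivative. -/
lemma IsRegularPoint.eventually_dist_le {x v : Plane} (h : IsRegularPoint f x v)
    (hf : Continuous f) {φ : Plane → ℝ} (hφ : DifferentiableAt ℝ φ x) {ε : ℝ} (hε : 0 < ε) :
    ∀ᶠ y in 𝓝[f '' Icc 0 1] x, dist (φ x) (φ y) ≤ (|⟪gradient φ x, v⟫| + ε) * dist x y := by
  set g := gradient φ x with hg
  -- Three errors add up: the Taylor remainder `η`, and `η * ‖g‖` twice, from the deviation from the
  -- tangent and from `|c| ≤ (1 + η) * ‖y - x‖`.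
  set η : ℝ := ε / (2 * ‖g‖ + 1) with hη
  have hη0 : 0 < η := by positivity
  have hd : HasGradientAt φ g x := hφ.hasGradientAt
  have h1 := ((hasGradientAt_iff_isLittleO.1 hd).bound hη0).filter_mono (nhdsWithin_le_nhds (s := f '' Icc 0 1))
  filter_upwards [h1, h.eventually_cone hf hη0] with y hy ⟨c, hc⟩
  rw [dist_comm, dist_comm x, Real.dist_eq, dist_eq_norm]
  rw [Real.norm_eq_abs] at hy
  have h2 : ⟪g, y - x⟫ = c * ⟪g, v⟫ + ⟪g, y - x - c • v⟫ := by
    rw [inner_sub_right g (y - x), inner_smul_right]; ring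
  have h3 : |⟪g, y - x - c • v⟫| ≤ ‖g‖ * (η * ‖y - x‖) :=
    (abs_real_inner_le_norm _ _).trans (by gcongr)
  have h4 : |c| ≤ (1 + η) * ‖y - x‖ := by
    have := norm_le_norm_add_norm_sub' (c • v) (y - x)
    rw [norm_smul, h.norm_eq_one, mul_one, Real.norm_eq_abs, norm_sub_rev (c • v)] at this
    linarith
  have h5 : |⟪g, v⟫| ≤ ‖g‖ := by
    simpa [h.norm_eq_one] using abs_real_inner_le_norm g v
  have h6 : |φ y - φ x| ≤ |φ y - φ x - ⟪g, y - x⟫| + |⟪g, y - x⟫| := by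
    simpa using abs_add_le (φ y - φ x - ⟪g, y - x⟫) ⟪g, y - x⟫
  have h7 : |⟪g, y - x⟫| ≤ |c| * |⟪g, v⟫| + |⟪g, y - x - c • v⟫| := by
    rw [h2, ← abs_mul]; exact abs_add_le _ _
  have h8 : |c| * |⟪g, v⟫| ≤ |⟪g, v⟫| * ‖y - x‖ + η * ‖g‖ * ‖y - x‖ := by
    calc |c| * |⟪g, v⟫| ≤ ((1 + η) * ‖y - x‖) * |⟪g, v⟫| := by gcongr
      _ = |⟪g, v⟫| * ‖y - x‖ + η * |⟪g, v⟫| * ‖y - x‖ := by ring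
      _ ≤ _ := by gcongr
  have h9 : η * (2 * ‖g‖ + 1) = ε := by rw [hη]; field_simp
  calc |φ y - φ x| ≤ |⟪g, v⟫| * ‖y - x‖ + η * (2 * ‖g‖ + 1) * ‖y - x‖ := by linarith
    _ = (|⟪g, v⟫| + ε) * ‖y - x‖ := by rw [h9]; ring

/-- The oscillation of a smooth function along an arc of the curve is bounded by the integral of
its tangential gradient over the trace of that arc. -/
lemma IsSmoothPair.ofReal_abs_sub_le (hKc : IsCompact K) (hK : IsPreconnected K)
    (hfin : Measure.hausdorffMeasure 1 K ≠ ⊤) (hf : LipschitzWith L f) (hfK : f '' Icc 0 1 = K)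
    {p : WithLp 2 (L2 K × L2Vec K)} {φ : Plane → ℝ} (hp : IsSmoothPair K p φ) {s t : ℝ}
    (hs : s ∈ Icc (0 : ℝ) 1) (ht : t ∈ Icc (0 : ℝ) 1) :
    ENNReal.ofReal |φ (f t) - φ (f s)| ≤ ∫⁻ x in f '' uIcc s t, ‖p.snd x‖ₑ ∂length K := by
  set E := f '' uIcc s t with hE
  have hEK : E ⊆ K := hfK ▸ image_mono (uIcc_subset_Icc hs ht)
  have hEc : IsCompact E := isCompact_uIcc.image hf.continuous
  have hres : (length K).restrict E = (Measure.hausdorffMeasure 1).restrict E :=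
    Measure.restrict_restrict_of_subset hEK
  have hdiff : Differentiable ℝ φ := hp.contDiff.differentiable (by simp)
  have key : Measure.hausdorffMeasure 1 (φ '' E) ≤
      ∫⁻ x in E, (‖p.snd x‖₊ : ℝ≥0) ∂Measure.hausdorffMeasure 1 := by
    refine hausdorffMeasure_image_le_lintegral ((measure_mono hEK).trans_lt hfin.lt_top).ne
      hEc.measurableSet (Lp.stronglyMeasurable p.snd).measurable.nnnorm ?_ ?_
    · intro N hN hN0
      obtain ⟨C, hC⟩ := LocallyLipschitzOn.exists_lipschitzOnWith_of_compact hEc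
        ((hp.contDiff.of_le (by simp)).locallyLipschitz.locallyLipschitzOn (s := E))
      have := (hC.mono hN).hausdorffMeasure_image_le (zero_le_one (α := ℝ))
      rw [hN0, mul_zero] at this
      exact nonpos_iff_eq_zero.1 this
    · rw [← hres]
      refine ae_restrict_of_ae ?_
      filter_upwards [hp.snd_ae_eq, ae_isRegularPoint_unitTangent hKc.measurableSet hK hf hfK]
        with x hx hxreg ε hε
      have hreg := hxreg.2
      have h1 := hreg.eventually_dist_le hf.continuous (hdiff x) (NNReal.coe_pos.2 hε)
      rw [hfK] at h1
      refine (h1.filter_mono (nhdsWithin_mono x hEK)).mono fun y hy => ?_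
      rwa [← norm_tangentialGradient hreg.norm_eq_one, ← hx] at hy
  -- Connectedness replaces integration along the parameter, so the number of times the arc covers a
  -- point plays no role.
  have hsub : uIcc (φ (f s)) (φ (f t)) ⊆ φ '' E := by
    have h1 : IsPreconnected (φ '' E) :=
      (isPreconnected_uIcc.image f hf.continuous.continuousOn).image φ
        hp.contDiff.continuous.continuousOn
    exact h1.ordConnected.uIcc_subset (mem_image_of_mem _ (mem_image_of_mem _ left_mem_uIcc))
      (mem_image_of_mem _ (mem_image_of_mem _ right_mem_uIcc))
  have h2 := (measure_mono hsub).trans key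
  rw [hausdorffMeasure_real, Real.volume_interval] at h2
  rw [hres]
  exact h2

/-- Cauchy–Schwarz on `C`; the square root of the length is the source of the Hölder exponent 1/2.
-/
lemma lintegral_enorm_le (h : L2Vec K) (C : Set Plane) :
    ∫⁻ x in C, ‖h x‖ₑ ∂length K ≤ ‖h‖ₑ * (length K C) ^ (1 / 2 : ℝ) := by
  have h1 := eLpNorm_le_eLpNorm_mul_rpow_measure_univ (μ := (length K).restrict C)
    (one_le_two (α := ℝ≥0∞)) (Lp.aestronglyMeasurable h).restrict
  rw [eLpNorm_one_eq_lintegral_enorm, Measure.restrict_apply_univ] at h1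
  refine h1.trans ?_
  rw [Lp.enorm_def, show (1 : ℝ) / (1 : ℝ≥0∞).toReal - 1 / (2 : ℝ≥0∞).toReal = 1 / 2 by norm_num]
  gcongr
  exact Measure.restrict_le_self

lemma length_image_uIcc_le (hf : LipschitzWith L f) (s t : ℝ) :
    length K (f '' uIcc s t) ≤ ENNReal.ofReal (L * |t - s|) := by
  refine (Measure.restrict_apply_le _ _).trans
    ((hf.hausdorffMeasure_image_le (zero_le_one (α := ℝ)) _).trans ?_)
  rw [hausdorffMeasure_real, Real.volume_interval, ENNReal.rpow_one, ENNReal.ofReal_mul L.coe_nonneg,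
    ENNReal.ofReal_coe_nnreal]

/-- Smooth functions are Hölder continuous along the curve, with a constant controlled by their
tangential gradient. -/
lemma IsSmoothPair.abs_sub_le (hKc : IsCompact K) (hK : IsPreconnected K)
    (hfin : Measure.hausdorffMeasure 1 K ≠ ⊤) (hf : LipschitzWith L f) (hfK : f '' Icc 0 1 = K)
    {p : WithLp 2 (L2 K × L2Vec K)} {φ : Plane → ℝ} (hp : IsSmoothPair K p φ) {s t : ℝ}
    (hs : s ∈ Icc (0 : ℝ) 1) (ht : t ∈ Icc (0 : ℝ) 1) :
    |φ (f t) - φ (f s)| ≤ √(L * |t - s|) * ‖p‖ := by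
  have h1 := (hp.ofReal_abs_sub_le hKc hK hfin hf hfK hs ht).trans (lintegral_enorm_le _ _)
  have h2 : ‖p.snd‖ₑ * (length K (f '' uIcc s t)) ^ (1 / 2 : ℝ) ≤
      ENNReal.ofReal (‖p‖ * √(L * |t - s|)) := by
    rw [ENNReal.ofReal_mul (norm_nonneg _), Real.sqrt_eq_rpow,
      ← ENNReal.ofReal_rpow_of_nonneg (by positivity) (by norm_num), ofReal_norm]
    gcongr
    · exact WithLp.enorm_snd_le _ p
    · exact length_image_uIcc_le hf s t
  rw [mul_comm]
  exact (ENNReal.ofReal_le_ofReal_iff (by positivity)).1 (h1.trans h2)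

/-- Smooth functions are bounded on `K` by their norm in `H¹(K)`. -/
lemma exists_abs_le (hKc : IsCompact K) (hK : IsPreconnected K) (hK0 : length K ≠ 0)
    (hfin : Measure.hausdorffMeasure 1 K ≠ ⊤) (hf : LipschitzWith L f) (hfK : f '' Icc 0 1 = K) :
    ∃ A : ℝ, 0 ≤ A ∧ ∀ p φ, IsSmoothPair K p φ → ∀ x ∈ K, |φ x| ≤ A * ‖p‖ := by
  set m : ℝ := (length K univ).toReal with hm
  have htop : length K univ ≠ ⊤ := by rwa [length, Measure.restrict_apply_univ]
  have hm0 : 0 < m := ENNReal.toReal_pos (Measure.measure_univ_ne_zero.2 hK0) htop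
  set c : ℝ := m ^ (1 / 2 : ℝ) with hc
  have hc0 : 0 < c := by positivity
  refine ⟨c⁻¹ + √L, by positivity, fun p φ hp x hx => ?_⟩
  obtain ⟨s, hs, rfl⟩ := hfK.symm ▸ hx
  -- The oscillation over all of `K` is at most `√L * ‖p‖`, so `|φ|` stays above `b` and its `L²`
  -- norm is at least `b * m ^ (1 / 2)` when `b ≥ 0`.
  have hosc : ∀ y ∈ K, |φ (f s)| - √L * ‖p‖ ≤ |φ y| := by
    intro y hy
    obtain ⟨t, ht, rfl⟩ := hfK.symm ▸ hy
    have h1 := hp.abs_sub_le hKc hK hfin hf hfK ht hs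
    have h2 : √(L * |s - t|) ≤ √L := by
      refine Real.sqrt_le_sqrt (mul_le_of_le_one_right L.coe_nonneg ?_)
      rw [abs_le]
      constructor <;> linarith [hs.1, hs.2, ht.1, ht.2]
    have h3 := mul_le_mul_of_nonneg_right h2 (norm_nonneg p)
    linarith [abs_sub_abs_le_abs_sub (φ (f s)) (φ (f t))]
  set b : ℝ := |φ (f s)| - √L * ‖p‖ with hb
  suffices H : b ≤ c⁻¹ * ‖p‖ by rw [add_mul]; linarith
  rcases le_total b 0 with hb0 | hb0
  · exact hb0.trans (by positivity)
  have h4 : eLpNorm (fun _ : Plane => b) 2 (length K) ≤ eLpNorm p.fst 2 (length K) := by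
    refine eLpNorm_mono_ae ?_
    filter_upwards [hp.fst_ae_eq, ae_restrict_mem hKc.measurableSet] with y hy hyK
    rw [hy, Real.norm_of_nonneg hb0, Real.norm_eq_abs]
    exact hosc y hyK
  rw [eLpNorm_const' _ two_ne_zero ENNReal.ofNat_ne_top, ← Lp.enorm_def] at h4
  have h5 := ENNReal.toReal_mono (by simp) (h4.trans (WithLp.enorm_fst_le _ p))
  rw [ENNReal.toReal_mul, toReal_enorm, toReal_enorm, ← ENNReal.toReal_rpow, ENNReal.toReal_ofNat,
    Real.norm_of_nonneg hb0] at h5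
  rw [inv_mul_eq_div, le_div_iff₀ hc0]
  exact h5

end SmoothPair

/-! ### Continuous representatives and uniform compactness -/

section Representative

variable {K : Set Plane} {f : ℝ → Plane} {L : ℝ≥0}

/-- The pairs `q n` of smooth functions `φ n` approximate `p`, and `φ n` converges uniformly on `K`
to the representative `v` of the function part of `p`. -/
structure IsApproximation (K : Set Plane) (q : ℕ → WithLp 2 (L2 K × L2Vec K))
    (φ : ℕ → Plane → ℝ) (p : WithLp 2 (L2 K × L2Vec K)) (v : Plane → ℝ) : Prop where
  isSmoothPair : ∀ n, IsSmoothPair K (q n) (φ n)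
  tendsto : Tendsto q atTop (𝓝 p)
  tendstoUniformlyOn : TendstoUniformlyOn φ v atTop K
  fst_ae_eq : p.fst =ᵐ[length K] v

/-- By the sup bound applied to differences, a sequence converging in the norm is uniformly Cauchy
on `K`. An almost everywhere convergent subsequence identifies its limit with `p.fst`. -/
lemma exists_isApproximation (hKc : IsCompact K) (hK : IsPreconnected K) (hK0 : length K ≠ 0)
    (hfin : Measure.hausdorffMeasure 1 K ≠ ⊤) (hf : LipschitzWith L f) (hfK : f '' Icc 0 1 = K)
    {p : WithLp 2 (L2 K × L2Vec K)} (hp : p ∈ H1 K) :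
    ∃ q φ v, IsApproximation K q φ p v := by
  have hp' : p ∈ closure (smoothFunctions K : Set (WithLp 2 (L2 K × L2Vec K))) := hp
  obtain ⟨q, hq, hqp⟩ := mem_closure_iff_seq_limit.1 hp'
  choose φ hφ1 hφ2 hφ3 using hq
  have hpair : ∀ n, IsSmoothPair K (q n) (φ n) := fun n => ⟨hφ1 n, hφ2 n, hφ3 n⟩
  obtain ⟨A, hA0, hA⟩ := exists_abs_le hKc hK hK0 hfin hf hfK
  have hC : UniformCauchySeqOn φ atTop K := by
    rw [Metric.uniformCauchySeqOn_iff]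
    intro ε hε
    obtain ⟨N, hN⟩ := Metric.cauchySeq_iff.1 hqp.cauchySeq (ε / (A + 1)) (by positivity)
    refine ⟨N, fun m hm n hn x hx => ?_⟩
    have h1 := hA _ _ ((hpair m).sub (hpair n)) x hx
    have h2 := hN m hm n hn
    rw [lt_div_iff₀ (by positivity), dist_eq_norm] at h2
    rw [Real.dist_eq]
    refine h1.trans_lt (lt_of_le_of_lt ?_ h2)
    rw [mul_comm]
    gcongr
    linarith
  have hlim : ∀ x ∈ K, ∃ y, Tendsto (fun n => φ n x) atTop (𝓝 y) := fun x hx =>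
    cauchySeq_tendsto_of_complete (hC.cauchySeq hx)
  choose! v hv using hlim
  refine ⟨q, φ, v, hpair, hqp, hC.tendstoUniformlyOn_of_tendsto hv, ?_⟩
  have hfst : Tendsto (fun n => (q n).fst) atTop (𝓝 p.fst) :=
    ((WithLp.fstL 2 ℝ (L2 K) (L2Vec K)).continuous.tendsto p).comp hqp
  obtain ⟨ns, hns, hae⟩ := (tendstoInMeasure_of_tendsto_Lp hfst).exists_seq_tendsto_ae
  filter_upwards [hae, ae_all_iff.2 hφ2, ae_restrict_mem hKc.measurableSet] with x hx1 hx2 hx3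
  refine tendsto_nhds_unique hx1 (((hv x hx3).comp hns.tendsto_atTop).congr fun n => ?_)
  exact (hx2 (ns n)).symm

namespace IsApproximation

variable {q : ℕ → WithLp 2 (L2 K × L2Vec K)} {φ : ℕ → Plane → ℝ}
  {p : WithLp 2 (L2 K × L2Vec K)} {v : Plane → ℝ}

lemma continuousOn (h : IsApproximation K q φ p v) : ContinuousOn v K :=
  h.tendstoUniformlyOn.continuousOn (Frequently.of_forall fun n =>
    (h.isSmoothPair n).contDiff.continuous.continuousOn)

lemma tendsto_apply (h : IsApproximation K q φ p v) {x : Plane} (hx : x ∈ K) :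
    Tendsto (fun n => φ n x) atTop (𝓝 (v x)) :=
  h.tendstoUniformlyOn.tendsto_at hx

lemma tendsto_snd (h : IsApproximation K q φ p v) :
    Tendsto (fun n => (q n).snd) atTop (𝓝 p.snd) :=
  ((WithLp.sndL 2 ℝ (L2 K) (L2Vec K)).continuous.tendsto p).comp h.tendsto

lemma abs_le (h : IsApproximation K q φ p v) {A : ℝ}
    (hA : ∀ p φ, IsSmoothPair K p φ → ∀ x ∈ K, |φ x| ≤ A * ‖p‖) {x : Plane} (hx : x ∈ K) :
    |v x| ≤ A * ‖p‖ :=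
  le_of_tendsto_of_tendsto' (h.tendsto_apply hx).abs (h.tendsto.norm.const_mul A)
    fun n => hA _ _ (h.isSmoothPair n) x hx

lemma abs_sub_le (h : IsApproximation K q φ p v) (hKc : IsCompact K) (hK : IsPreconnected K)
    (hfin : Measure.hausdorffMeasure 1 K ≠ ⊤) (hf : LipschitzWith L f) (hfK : f '' Icc 0 1 = K)
    {s t : ℝ} (hs : s ∈ Icc (0 : ℝ) 1) (ht : t ∈ Icc (0 : ℝ) 1) :
    |v (f t) - v (f s)| ≤ √(L * |t - s|) * ‖p‖ :=
  le_of_tendsto_of_tendsto' ((h.tendsto_apply (hfK ▸ mem_image_of_mem f ht)).sub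
    (h.tendsto_apply (hfK ▸ mem_image_of_mem f hs))).abs (h.tendsto.norm.const_mul _)
    fun n => (h.isSmoothPair n).abs_sub_le hKc hK hfin hf hfK hs ht

/-- Passage to the limit in the estimate for smooth functions: on an arc the `L¹` distance of the
gradients is controlled by their `L²` distance, the length being finite. -/
lemma ofReal_abs_sub_le (h : IsApproximation K q φ p v) (hKc : IsCompact K)
    (hK : IsPreconnected K) (hfin : Measure.hausdorffMeasure 1 K ≠ ⊤) (hf : LipschitzWith L f)
    (hfK : f '' Icc 0 1 = K) {s t : ℝ} (hs : s ∈ Icc (0 : ℝ) 1) (ht : t ∈ Icc (0 : ℝ) 1) :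
    ENNReal.ofReal |v (f t) - v (f s)| ≤ ∫⁻ x in f '' uIcc s t, ‖p.snd x‖ₑ ∂length K := by
  set E := f '' uIcc s t with hE
  have htop : length K E ≠ ⊤ :=
    ((Measure.restrict_apply_le _ _).trans_lt ((measure_mono (show E ⊆ K from
      hfK ▸ image_mono (uIcc_subset_Icc hs ht))).trans_lt hfin.lt_top)).ne
  have h1 : Tendsto (fun n => ENNReal.ofReal |φ n (f t) - φ n (f s)|) atTop
      (𝓝 (ENNReal.ofReal |v (f t) - v (f s)|)) :=
    ENNReal.tendsto_ofReal ((h.tendsto_apply (hfK ▸ mem_image_of_mem f ht)).sub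
      (h.tendsto_apply (hfK ▸ mem_image_of_mem f hs))).abs
  have h2 : Tendsto (fun n => ∫⁻ x in E, ‖p.snd x‖ₑ ∂length K +
      ‖(q n).snd - p.snd‖ₑ * (length K E) ^ (1 / 2 : ℝ)) atTop
      (𝓝 (∫⁻ x in E, ‖p.snd x‖ₑ ∂length K + 0 * (length K E) ^ (1 / 2 : ℝ))) := by
    refine tendsto_const_nhds.add (ENNReal.Tendsto.mul_const ?_ (Or.inr ?_))
    · have := (h.tendsto_snd.sub_const p.snd).enorm
      simpa using this
    · exact ENNReal.rpow_ne_top_of_nonneg (by norm_num) htop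
  rw [zero_mul, add_zero] at h2
  refine le_of_tendsto_of_tendsto' h1 h2 fun n => ?_
  refine ((h.isSmoothPair n).ofReal_abs_sub_le hKc hK hfin hf hfK hs ht).trans ?_
  calc ∫⁻ x in E, ‖(q n).snd x‖ₑ ∂length K
      ≤ ∫⁻ x in E, (‖p.snd x‖ₑ + ‖((q n).snd - p.snd) x‖ₑ) ∂length K := by
        refine lintegral_mono_ae (ae_restrict_of_ae ?_)
        filter_upwards [Lp.coeFn_sub (q n).snd p.snd] with x hx
        rw [hx, Pi.sub_apply]
        calc ‖(q n).snd x‖ₑ = ‖p.snd x + ((q n).snd x - p.snd x)‖ₑ := by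
              rw [add_sub_cancel]
          _ ≤ _ := enorm_add_le _ _
    _ = ∫⁻ x in E, ‖p.snd x‖ₑ ∂length K + ∫⁻ x in E, ‖((q n).snd - p.snd) x‖ₑ ∂length K :=
        lintegral_add_left (Lp.stronglyMeasurable p.snd).enorm _
    _ ≤ _ := by
        gcongr
        exact lintegral_enorm_le _ _

/-- Serves to apply the arc estimate to the difference between a limit and one of its approximants,
in the proof of injectivity. -/
lemma sub_isSmoothPair (h : IsApproximation K q φ p v) {p' : WithLp 2 (L2 K × L2Vec K)}
    {ψ : Plane → ℝ} (h' : IsSmoothPair K p' ψ) :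
    IsApproximation K (fun n => q n - p') (fun n => φ n - ψ) (p - p') (v - ψ) where
  isSmoothPair n := (h.isSmoothPair n).sub h'
  tendsto := h.tendsto.sub_const p'
  tendstoUniformlyOn := by
    have := h.tendstoUniformlyOn
    rw [Metric.tendstoUniformlyOn_iff] at this ⊢
    simpa using this
  fst_ae_eq := by
    rw [WithLp.sub_fst]
    exact (Lp.coeFn_sub _ _).trans (h.fst_ae_eq.sub h'.fst_ae_eq)

end IsApproximation

/-- A bounded sequence in `H¹(K)` has continuous representatives, a subsequence of which converges
uniformly on `K`. -/
lemma exists_subseq_tendstoUniformlyOn (hKc : IsCompact K) (hK : IsPreconnected K)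
    (hK0 : length K ≠ 0) (hfin : Measure.hausdorffMeasure 1 K ≠ ⊤) (hf : LipschitzWith L f)
    (hfK : f '' Icc 0 1 = K) (u : ℕ → H1 K) {C : ℝ} (hu : ∀ n, ‖u n‖ ≤ C) :
    ∃ v : ℕ → Plane → ℝ, (∀ n, ContinuousOn (v n) K ∧ H1.toL2 K (u n) =ᵐ[length K] v n) ∧
      ∃ k : ℕ → ℕ, StrictMono k ∧ ∃ w : Plane → ℝ, ContinuousOn w K ∧
        TendstoUniformlyOn (fun j => v (k j)) w atTop K := by
  obtain ⟨A, hA0, hA⟩ := exists_abs_le hKc hK hK0 hfin hf hfK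
  choose q φ v hv using fun n => exists_isApproximation hKc hK hK0 hfin hf hfK (u n).2
  have hnorm : ∀ n, ‖(u n : WithLp 2 (L2 K × L2Vec K))‖ ≤ C := hu
  refine ⟨v, fun n => ⟨(hv n).continuousOn, (hv n).fst_ae_eq⟩, ?_⟩
  have hmem : ∀ t : Icc (0 : ℝ) 1, f t ∈ K := fun t => hfK ▸ mem_image_of_mem f t.2
  let F : ℕ → BoundedContinuousFunction (Icc (0 : ℝ) 1) ℝ := fun n =>
    BoundedContinuousFunction.mkOfCompact ⟨fun t => v n (f t),
      (hv n).continuousOn.comp_continuous (hf.continuous.comp continuous_subtype_val) hmem⟩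
  -- Arzelà–Ascoli is applied after pulling back to `[0, 1]`, where the Hölder bound is a common
  -- modulus of continuity.
  have hequi : Equicontinuous fun (g : range F) (t : Icc (0 : ℝ) 1) => (g : Icc (0 : ℝ) 1 → ℝ) t := by
    refine Metric.equicontinuous_of_continuity_modulus (fun r => √(L * |r|) * C) ?_ _ ?_
    · refine Continuous.tendsto' (by fun_prop) _ _ (by simp)
    · rintro s t ⟨_, n, rfl⟩
      change dist (v n (f s)) (v n (f t)) ≤ _
      rw [Real.dist_eq, Subtype.dist_eq, Real.dist_eq, abs_abs]
      refine ((hv n).abs_sub_le hKc hK hfin hf hfK t.2 s.2).trans ?_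
      gcongr
      exact hnorm n
  have hcomp : IsCompact (closure (range F)) := by
    refine BoundedContinuousFunction.arzela_ascoli (Icc (-(A * C)) (A * C)) isCompact_Icc _ ?_ hequi
    rintro _ t ⟨n, rfl⟩
    exact _root_.abs_le.1 (((hv n).abs_le hA (hmem t)).trans (by gcongr; exact hnorm n))
  obtain ⟨G, -, k, hk, hkG⟩ := hcomp.tendsto_subseq fun n => subset_closure (mem_range_self (f := F) n)
  have hpre : ∀ x ∈ K, ∃ t : Icc (0 : ℝ) 1, f t = x := by
    intro x hx
    obtain ⟨t, ht, rfl⟩ := hfK.symm ▸ hx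
    exact ⟨⟨t, ht⟩, rfl⟩
  -- The section `τ` need not be continuous: the limit is continuous on `K` as a uniform limit.
  choose! τ hτ using hpre
  have hunif : TendstoUniformlyOn (fun j => v (k j)) (fun x => G (τ x)) atTop K := by
    rw [Metric.tendstoUniformlyOn_iff]
    intro ε hε
    filter_upwards [Metric.tendsto_nhds.1 hkG ε hε] with j hj x hx
    have h1 : v (k j) x = F (k j) (τ x) := congrArg (v (k j)) (hτ x hx).symm
    rw [h1, dist_comm]
    exact (BoundedContinuousFunction.dist_coe_le_dist _).trans_lt hj
  exact ⟨k, hk, _, hunif.continuousOn (Frequently.of_forall fun j => (hv (k j)).continuousOn), hunif⟩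

/-- Uniform convergence on `K` implies convergence in `L²(K)`. -/
lemma exists_tendsto_of_tendstoUniformlyOn (hKc : IsCompact K)
    (hfin : Measure.hausdorffMeasure 1 K ≠ ⊤) {U : ℕ → L2 K} {v : ℕ → Plane → ℝ}
    (hU : ∀ n, U n =ᵐ[length K] v n) {w : Plane → ℝ} (hw : ContinuousOn w K)
    (hvw : TendstoUniformlyOn v w atTop K) :
    ∃ W : L2 K, W =ᵐ[length K] w ∧ Tendsto U atTop (𝓝 W) := by
  have : IsFiniteMeasure (length K) :=
    ⟨by rw [length, Measure.restrict_apply_univ]; exact hfin.lt_top⟩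
  obtain ⟨B, hB⟩ := hKc.exists_bound_of_continuousOn hw
  have hmem : MemLp w 2 (length K) := MemLp.of_bound
    (hw.aestronglyMeasurable hKc.measurableSet) B
    ((ae_restrict_mem hKc.measurableSet).mono fun x hx => hB x hx)
  refine ⟨hmem.toLp w, hmem.coeFn_toLp, ?_⟩
  rw [tendsto_iff_norm_sub_tendsto_zero, Metric.tendsto_nhds]
  intro ε hε
  set a : ℝ := (measureUnivNNReal (length K) : ℝ) ^ (2 : ℝ≥0∞).toReal⁻¹ with ha
  have ha0 : 0 ≤ a := by positivity
  filter_upwards [Metric.tendstoUniformlyOn_iff.1 hvw (ε / (a + 1)) (by positivity)] with n hn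
  rw [dist_zero_right, norm_norm]
  have h1 : ‖U n - hmem.toLp w‖ ≤ a * (ε / (a + 1)) := by
    refine Lp.norm_le_of_ae_bound (by positivity) ?_
    filter_upwards [Lp.coeFn_sub (U n) (hmem.toLp w), hU n, hmem.coeFn_toLp,
      ae_restrict_mem hKc.measurableSet] with x h1 h2 h3 h4
    rw [h1, Pi.sub_apply, h2, h3, ← dist_eq_norm, dist_comm]
    exact (hn x h4).le
  refine h1.trans_lt ?_
  rw [mul_div_assoc', div_lt_iff₀ (by positivity)]
  nlinarith

end Representative

/-! ### Compact operators through sequences -/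

/-- A continuous linear map sending bounded sequences to sequences with convergent subsequences is
compact. -/
lemma isCompactOperator_of_exists_subseq {E F : Type*} [NormedAddCommGroup E] [NormedSpace ℝ E]
    [NormedAddCommGroup F] [NormedSpace ℝ F] (T : E →L[ℝ] F)
    (h : ∀ u : ℕ → E, (∀ n, ‖u n‖ ≤ 1) → ∃ k : ℕ → ℕ, StrictMono k ∧
      ∃ W, Tendsto (fun j => T (u (k j))) atTop (𝓝 W)) : IsCompactOperator T := by
  refine (isCompactOperator_iff_isCompact_closure_image_closedBall (T : E →ₗ[ℝ] F) one_pos).2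
    (IsSeqCompact.isCompact ?_)
  intro y hy
  have hex : ∀ n : ℕ, ∃ u : E, ‖u‖ ≤ 1 ∧ dist (y n) (T u) < 1 / ((n : ℝ) + 1) := by
    intro n
    obtain ⟨_, ⟨u, hu, rfl⟩, hd⟩ := Metric.mem_closure_iff.1 (hy n) (1 / ((n : ℝ) + 1))
      (by positivity)
    exact ⟨u, by simpa using hu, hd⟩
  choose u hu hd using hex
  obtain ⟨k, hk, W, hW⟩ := h u hu
  have hlim : Tendsto (y ∘ k) atTop (𝓝 W) := by
    refine hW.congr_dist (squeeze_zero (fun _ => dist_nonneg) (fun j => ?_)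
      (tendsto_one_div_add_atTop_nhds_zero_nat.comp hk.tendsto_atTop))
    rw [dist_comm]
    exact (hd (k j)).le
  exact ⟨W, isClosed_closure.mem_of_tendsto hlim (Eventually.of_forall fun j => hy (k j)), k, hk,
    hlim⟩

/-! ### Closability of the tangential gradient -/

section Injectivity

variable {K : Set Plane} {f : ℝ → Plane} {L : ℝ≥0}

/-- A function continuous on a continuum and vanishing almost everywhere vanishes. -/
lemma eq_zero_of_ae_eq_zero (hK : IsPreconnected K) (hK0 : length K ≠ 0) {v : Plane → ℝ}
    (hv : ContinuousOn v K) (hKm : MeasurableSet K) (h0 : v =ᵐ[length K] 0) {x : Plane}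
    (hx : x ∈ K) : v x = 0 := by
  by_contra hne
  have h1 : ∀ᶠ y in 𝓝[K] x, v y ≠ 0 := (hv x hx).eventually_ne hne
  obtain ⟨δ, hδ, hsub⟩ := Metric.mem_nhdsWithin_iff.1 h1
  -- Small balls about points of `K` have positive length, so `v` cannot be nonzero on one of them.
  obtain ⟨r, hr, hr0, hrδ⟩ := ((eventually_ofReal_le_length hK hK0 hx).and
    (eventually_mem_nhdsWithin.and (nhdsWithin_le_nhds (Iic_mem_nhds hδ)))).exists
  have h2 : length K (Metric.ball x r) = 0 := by
    rw [length, Measure.restrict_apply' hKm]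
    have h3 : length K {y | v y ≠ 0} = 0 := h0
    rw [length, Measure.restrict_apply' hKm] at h3
    have h4 : Metric.ball x r ∩ K ⊆ {y | v y ≠ 0} ∩ K := fun y hy =>
      ⟨hsub ⟨Metric.ball_subset_ball hrδ hy.1, hy.2⟩, hy.2⟩
    exact measure_mono_null h4 h3
  rw [h2, nonpos_iff_eq_zero, ENNReal.ofReal_eq_zero] at hr
  exact absurd hr0 (not_lt.2 hr)

/-- At a regular Lebesgue point of `G`, the tangential derivative of a function whose oscillation
along arcs is bounded by integrals of `G` is bounded by a multiple of `G`. -/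
lemma IsRegularPoint.exists_ofReal_abs_inner_le {x v : Plane} (h : IsRegularPoint f x v)
    (hf : LipschitzWith L f) (hfK : f '' Icc 0 1 = K) (hx : x ∈ K) :
    ∃ C : ℝ≥0, ∀ (φ : Plane → ℝ) (G : Plane → ℝ≥0∞), DifferentiableAt ℝ φ x →
      (∀ s ∈ Icc (0 : ℝ) 1, ∀ t ∈ Icc (0 : ℝ) 1,
        ENNReal.ofReal |φ (f t) - φ (f s)| ≤ ∫⁻ y in f '' uIcc s t, G y ∂length K) →
      Tendsto (fun r => (∫⁻ y in Metric.closedBall x r, G y ∂length K) /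
        length K (Metric.closedBall x r)) (𝓝[>] 0) (𝓝 (G x)) →
      ENNReal.ofReal |⟪gradient φ x, v⟫| ≤ G x * C := by
  obtain ⟨M, hM⟩ := h.exists_density_le hf
  rw [hfK] at hM
  obtain ⟨t, ht, htx⟩ := hfK.symm ▸ hx
  obtain ⟨ht1, c, hc, hd⟩ := h.hasDerivAt t ht htx
  have hc0 : 0 < |c| := abs_pos.2 hc
  have hL0 : 0 < (L : ℝ) + 1 := by positivity
  -- An arc of duration `r` lies in the ball of radius `(L + 1) * r`, of length at most `M * (L + 1)
  -- * r`; division by the speed `|c|` gives `C`. It depends on the point alone, so it serves all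
  -- approximants. `L + 1` keeps the radius positive.
  refine ⟨M * (L + 1) * Real.toNNReal |c|⁻¹, fun φ G hφ hosc hG => ?_⟩
  have hr0 : Tendsto (fun r : ℝ => ((L : ℝ) + 1) * r) (𝓝[>] 0) (𝓝[>] 0) := by
    refine tendsto_nhdsWithin_iff.2 ⟨?_, ?_⟩
    · exact (Continuous.tendsto' (by fun_prop) 0 0 (by simp)).mono_left nhdsWithin_le_nhds
    · exact eventually_mem_nhdsWithin.mono fun r hr => mul_pos hL0 hr
  have hderiv : HasDerivAt (fun s => φ (f s)) (c * ⟪gradient φ x, v⟫) t := by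
    have h1 : HasFDerivAt φ (InnerProductSpace.toDual ℝ Plane (gradient φ x)) (f t) := by
      rw [htx]; exact hφ.hasGradientAt.hasFDerivAt
    have h2 := h1.comp_hasDerivAt t hd
    rwa [InnerProductSpace.toDual_apply_apply, inner_smul_right] at h2
  have h1 := ENNReal.tendsto_ofReal hderiv.tendsto_slope_zero_right.abs
  have h2 := ENNReal.Tendsto.mul_const (b := (M * (L + 1) : ℝ≥0)) (hG.comp hr0)
    (Or.inr ENNReal.coe_ne_top)
  have key : ENNReal.ofReal |c * ⟪gradient φ x, v⟫| ≤ G x * (M * (L + 1) : ℝ≥0) := by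
    refine le_of_tendsto_of_tendsto h1 h2 ?_
    -- The difference quotient is one-sided, so the arc from `t` to `t + r` needs `t < 1`; this is
    -- why regular points exclude the final parameter.
    filter_upwards [hr0.eventually hM, eventually_mem_nhdsWithin,
      nhdsWithin_le_nhds (Iic_mem_nhds (sub_pos.2 ht1))] with r hr hr0 hr1
    have hr0' : 0 < r := hr0
    have hr1' : r ≤ 1 - t := hr1
    set B := Metric.closedBall x (((L : ℝ) + 1) * r) with hB
    have hsub : f '' uIcc t (t + r) ⊆ B := by
      rintro _ ⟨s, hs, rfl⟩
      rw [uIcc_of_le (by linarith)] at hs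
      rw [hB, Metric.mem_closedBall, ← htx]
      refine (hf.dist_le_mul s t).trans ?_
      have h3 : dist s t ≤ r := by
        rw [Real.dist_eq, _root_.abs_le]
        constructor <;> linarith [hs.1, hs.2]
      calc (L : ℝ) * dist s t ≤ L * r := by gcongr
        _ ≤ ((L : ℝ) + 1) * r := by gcongr; linarith
    have h3 := (hosc t ht (t + r) ⟨by linarith [ht.1], by linarith⟩).trans
      (lintegral_mono_set hsub)
    have h4 : ENNReal.ofReal |r⁻¹ • (φ (f (t + r)) - φ (f t))| =
        (ENNReal.ofReal r)⁻¹ * ENNReal.ofReal |φ (f (t + r)) - φ (f t)| := by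
      rw [smul_eq_mul, abs_mul, abs_of_pos (inv_pos.2 hr0'), ENNReal.ofReal_mul (by positivity),
        ENNReal.ofReal_inv_of_pos hr0']
    have htop : length K B ≠ ⊤ := (hr.trans_lt (by finiteness)).ne
    have h5 : ∫⁻ y in B, G y ∂length K = (∫⁻ y in B, G y ∂length K) / length K B * length K B :=
      (ENNReal.div_mul_cancel' (fun h0 => setLIntegral_measure_zero _ _ h0)
        (fun h0 => (htop h0).elim)).symm
    rw [h4]
    calc (ENNReal.ofReal r)⁻¹ * ENNReal.ofReal |φ (f (t + r)) - φ (f t)|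
        ≤ (ENNReal.ofReal r)⁻¹ * ((∫⁻ y in B, G y ∂length K) / length K B *
            (M * ENNReal.ofReal (((L : ℝ) + 1) * r))) := by
          gcongr
          refine h3.trans (h5.le.trans ?_)
          gcongr
      _ = (∫⁻ y in B, G y ∂length K) / length K B * (M * (L + 1) : ℝ≥0) *
            ((ENNReal.ofReal r)⁻¹ * ENNReal.ofReal r) := by
          have h6 : ENNReal.ofReal ((L : ℝ) + 1) = ((L + 1 : ℝ≥0) : ℝ≥0∞) := by
            rw [← ENNReal.ofReal_coe_nnreal]; rfl
          rw [ENNReal.ofReal_mul hL0.le, h6, ENNReal.coe_mul]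
          ring
      _ = (∫⁻ y in B, G y ∂length K) / length K B * (M * (L + 1) : ℝ≥0) := by
          rw [ENNReal.inv_mul_cancel (by simpa using hr0') ENNReal.ofReal_ne_top, mul_one]
  calc ENNReal.ofReal |⟪gradient φ x, v⟫|
      = ENNReal.ofReal |c * ⟪gradient φ x, v⟫| * ENNReal.ofReal |c|⁻¹ := by
        rw [← ENNReal.ofReal_mul (abs_nonneg _), abs_mul]
        congr 1
        field_simp
    _ ≤ G x * (M * (L + 1) : ℝ≥0) * ENNReal.ofReal |c|⁻¹ := by gcongr
    _ = G x * (M * (L + 1) * Real.toNNReal |c|⁻¹ : ℝ≥0) := by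
        rw [ENNReal.coe_mul (M * (L + 1)), mul_assoc]; rfl

/-- An element of `H¹(K)` whose function part vanishes has vanishing gradient. -/
lemma snd_eq_zero_of_fst_eq_zero (hKc : IsCompact K) (hK : IsPreconnected K) (hK0 : length K ≠ 0)
    (hfin : Measure.hausdorffMeasure 1 K ≠ ⊤) (hf : LipschitzWith L f) (hfK : f '' Icc 0 1 = K)
    {p : WithLp 2 (L2 K × L2Vec K)} (hp : p ∈ H1 K) (hp0 : p.fst = 0) : p.snd = 0 := by
  have : IsFiniteMeasure (length K) :=
    ⟨by rw [length, Measure.restrict_apply_univ]; exact hfin.lt_top⟩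
  obtain ⟨q, φ, v, h⟩ := exists_isApproximation hKc hK hK0 hfin hf hfK hp
  have hv : ∀ x ∈ K, v x = 0 := fun x hx =>
    eq_zero_of_ae_eq_zero hK hK0 h.continuousOn hKc.measurableSet
      (h.fst_ae_eq.symm.trans (by rw [hp0]; exact Lp.coeFn_zero _ _ _)) hx
  -- Since the representative `v` vanishes on `K`, the oscillation of `v - φ m` is that of `φ m`.
  let G : ℕ → Plane → ℝ≥0∞ := fun m x => ‖(p - q m).snd x‖ₑ
  have hosc : ∀ m, ∀ s ∈ Icc (0 : ℝ) 1, ∀ t ∈ Icc (0 : ℝ) 1,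
      ENNReal.ofReal |φ m (f t) - φ m (f s)| ≤ ∫⁻ y in f '' uIcc s t, G m y ∂length K := by
    intro m s hs t ht
    have h1 := (h.sub_isSmoothPair (h.isSmoothPair m)).ofReal_abs_sub_le hKc hK hfin hf hfK hs ht
    rw [Pi.sub_apply, Pi.sub_apply, hv _ (hfK ▸ mem_image_of_mem f ht),
      hv _ (hfK ▸ mem_image_of_mem f hs), zero_sub, zero_sub, neg_sub_neg, abs_sub_comm] at h1
    exact h1
  have hleb : ∀ᵐ x ∂length K, ∀ m, Tendsto (fun r =>
      (∫⁻ y in Metric.closedBall x r, G m y ∂length K) / length K (Metric.closedBall x r))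
      (𝓝[>] 0) (𝓝 (G m x)) := by
    refine ae_all_iff.2 fun m => ?_
    have hGfin : ∫⁻ y, G m y ∂length K ≠ ⊤ := by
      have h1 := lintegral_enorm_le (p - q m).snd univ
      rw [Measure.restrict_univ] at h1
      exact (h1.trans_lt (ENNReal.mul_lt_top enorm_lt_top
        (ENNReal.rpow_lt_top_of_nonneg (by norm_num) (measure_ne_top _ _)))).ne
    filter_upwards [(Besicovitch.vitaliFamily (length K)).ae_tendsto_lintegral_div
      (Lp.stronglyMeasurable (p - q m).snd).enorm.aemeasurable hGfin] with x hx
    exact hx.comp (Besicovitch.tendsto_filterAt _ x)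
  obtain ⟨ns, -, hae⟩ := (tendstoInMeasure_of_tendsto_Lp h.tendsto_snd).exists_seq_tendsto_ae
  have hsub : ∀ᵐ x ∂length K, ∀ m, (p - q m).snd x = p.snd x - (q m).snd x :=
    ae_all_iff.2 fun m => by rw [WithLp.sub_snd]; exact Lp.coeFn_sub _ _
  have htan : ∀ᵐ x ∂length K, ∀ m, (q m).snd x = tangentialGradient K (φ m) x :=
    ae_all_iff.2 fun m => (h.isSmoothPair m).snd_ae_eq
  refine Lp.ext (EventuallyEq.trans ?_ (Lp.coeFn_zero _ _ _).symm)
  filter_upwards [ae_isRegularPoint_unitTangent hKc.measurableSet hK hf hfK, hleb, hae, hsub, htan]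
    with x hxreg hxleb hxae hxsub hxtan
  obtain ⟨hxK, hreg⟩ := hxreg
  obtain ⟨C, hC⟩ := hreg.exists_ofReal_abs_inner_le hf hfK hxK
  have hbound : ∀ m, ‖(q m).snd x‖ₑ ≤ G m x * C := by
    intro m
    rw [hxtan m, ← ofReal_norm, norm_tangentialGradient hreg.norm_eq_one]
    exact hC _ _ ((h.isSmoothPair m).contDiff.differentiable (by simp) x) (hosc m) (hxleb m)
  have hG0 : Tendsto (fun i => G (ns i) x * C) atTop (𝓝 (0 * C)) := by
    refine ENNReal.Tendsto.mul_const ?_ (Or.inr ENNReal.coe_ne_top)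
    have h1 := (hxae.const_sub (p.snd x)).enorm
    rw [sub_self, enorm_zero] at h1
    exact h1.congr fun i => by rw [← hxsub]
  rw [zero_mul] at hG0
  -- In the limit the left side tends to `‖p.snd x‖ₑ` and the right side to zero.
  have h0 := le_of_tendsto_of_tendsto' hxae.enorm hG0 fun i => hbound (ns i)
  simpa using h0

end Injectivity

end SobolevCurve

/-! ### Conclusion -/

/-- For `K ∈ 𝒦(Ω)` the canonical map `H¹(K) → L²(K)` is injective and compact; moreover, for every
bounded sequence in `H¹(K)`, its members have representatives that are continuous on `K`, and a
subsequence of these converges uniformly on `K`, and hence in `L²(K)`, to the same limit. -/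
theorem corollary2p5 (Ω : Set SobolevCurve.Plane) (hΩ : IsOpen Ω) (K : Set SobolevCurve.Plane)
    (hK : K ∈ SobolevCurve.admissible Ω) :
    Function.Injective (SobolevCurve.H1.toL2 K) ∧
    IsCompactOperator (SobolevCurve.H1.toL2 K) ∧
    ∀ u : ℕ → SobolevCurve.H1 K, (∃ C : ℝ, ∀ n, ‖u n‖ ≤ C) →
      ∃ v : ℕ → SobolevCurve.Plane → ℝ,
        (∀ n, ContinuousOn (v n) K ∧
          SobolevCurve.H1.toL2 K (u n) =ᵐ[SobolevCurve.length K] v n) ∧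
        ∃ k : ℕ → ℕ, StrictMono k ∧
          ∃ w : SobolevCurve.Plane → ℝ, ContinuousOn w K ∧
            TendstoUniformlyOn (fun j => v (k j)) w atTop K ∧
            ∃ W : SobolevCurve.L2 K, W =ᵐ[SobolevCurve.length K] w ∧
              Tendsto (fun j => SobolevCurve.H1.toL2 K (u (k j))) atTop (𝓝 W) := by
  obtain ⟨-, hKc, hKconn, hfin⟩ := hK
  have hKp := hKconn.isPreconnected
  obtain ⟨L, f, hf, hfK⟩ := SobolevCurve.exists_lipschitz_parametrization hKc hKconn hfin.ne
  have hzero : SobolevCurve.length K = 0 → ∀ P : SobolevCurve.Plane → Prop,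
      ∀ᵐ x ∂SobolevCurve.length K, P x := fun h P => by simp [h]
  have hseq : ∀ u : ℕ → SobolevCurve.H1 K, (∃ C : ℝ, ∀ n, ‖u n‖ ≤ C) →
      ∃ v : ℕ → SobolevCurve.Plane → ℝ,
        (∀ n, ContinuousOn (v n) K ∧
          SobolevCurve.H1.toL2 K (u n) =ᵐ[SobolevCurve.length K] v n) ∧
        ∃ k : ℕ → ℕ, StrictMono k ∧
          ∃ w : SobolevCurve.Plane → ℝ, ContinuousOn w K ∧
            TendstoUniformlyOn (fun j => v (k j)) w atTop K ∧
            ∃ W : SobolevCurve.L2 K, W =ᵐ[SobolevCurve.length K] w ∧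
              Tendsto (fun j => SobolevCurve.H1.toL2 K (u (k j))) atTop (𝓝 W) := by
    rintro u ⟨C, hC⟩
    suffices H : ∃ v : ℕ → SobolevCurve.Plane → ℝ, (∀ n, ContinuousOn (v n) K ∧
        SobolevCurve.H1.toL2 K (u n) =ᵐ[SobolevCurve.length K] v n) ∧
        ∃ k : ℕ → ℕ, StrictMono k ∧ ∃ w : SobolevCurve.Plane → ℝ, ContinuousOn w K ∧
          TendstoUniformlyOn (fun j => v (k j)) w atTop K by
      obtain ⟨v, hv, k, hk, w, hw, hvw⟩ := H
      exact ⟨v, hv, k, hk, w, hw, hvw, SobolevCurve.exists_tendsto_of_tendstoUniformlyOn hKc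
        hfin.ne (fun j => (hv (k j)).2) hw hvw⟩
    -- When `K` has length zero, every statement holds almost everywhere, so the zero function
    -- represents each class.
    by_cases hK0 : SobolevCurve.length K = 0
    · refine ⟨fun _ _ => 0, fun n => ⟨continuousOn_const, hzero hK0 _⟩, id, strictMono_id,
        fun _ => 0, continuousOn_const, ?_⟩
      rw [Metric.tendstoUniformlyOn_iff]
      intro ε hε
      exact Eventually.of_forall fun _ _ _ => by rwa [dist_self]
    · exact SobolevCurve.exists_subseq_tendstoUniformlyOn hKc hKp hK0 hfin.ne hf hfK u hC
  refine ⟨?_, SobolevCurve.isCompactOperator_of_exists_subseq _ fun u hu => ?_, hseq⟩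
  · refine (injective_iff_map_eq_zero _).2 fun p hp => ?_
    have hp0 : (p : WithLp 2 (SobolevCurve.L2 K × SobolevCurve.L2Vec K)).fst = 0 := hp
    have hp1 : (p : WithLp 2 (SobolevCurve.L2 K × SobolevCurve.L2Vec K)).snd = 0 := by
      by_cases hK0 : SobolevCurve.length K = 0
      · exact Lp.ext (hzero hK0 _)
      · exact SobolevCurve.snd_eq_zero_of_fst_eq_zero hKc hKp hK0 hfin.ne hf hfK p.2 hp0
    exact Subtype.ext (WithLp.ofLp_injective 2 (Prod.ext hp0 hp1))
  · obtain ⟨v, -, k, hk, w, -, -, W, -, hW⟩ := hseq u ⟨1, hu⟩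
    exact ⟨k, hk, W, hW⟩
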